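/- Let $\pi:E\to M$ be a smooth fibred manifold with $\dim M=m>1$ (for example a fibre bundle), $\eta$ a volume form on $M$, and $J^1\pi$ the first jet bundle, with $\omega$ the pull-back of $\eta$ to $J^1\pi$ and local coordinates $(x^\alpha,y^A,v^A_\alpha)$ such that $\omega=dx^1\wedge\dots\wedge dx^m$. Let $\mathcal L=L\,\omega$ be a Lagrangian density with $L\in C^\infty(J^1\pi)$, let $\mathcal V$ be the vertical endomorphism of $J^1\pi$ (locally $\mathcal V=(dy^A-v^A_\alpha dx^\alpha)\wedge i(\partial/\partial x^\nu)\omega\otimes\partial/\partial v^A_\nu$), and let $\Theta_{\mathcal L}=i(\mathcal V)\mathcal L+\mathcal L$ and $\Omega_{\mathcal L}=-d\Theta_{\mathcal L}$ be the Poincaré–Cartan forms, that is, locally $\Theta_{\mathcal L}=\frac{\partial L}{\partial v^A_\alpha}(dy^A-v^A_\beta dx^\beta)\wedge i(\partial/\partial x^\alpha)\omega+L\,\omega$. Let $\mathcal F\mathcal L:J^1\pi\to J^1\pi^*$ be the restricted Legendre map (over the identity of $E$, with $p^\alpha_A=\partial L/\partial v^A_\alpha$). Assume that the system is almost-regular: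 $\mathcal P=\mathcal F\mathcal L(J^1\pi)$ is a closed submanifold of $J^1\pi^*$, $\mathcal F\mathcal L$ is a submersion onto $\mathcal P$, and the fibres of $\mathcal F\mathcal L$ are connected submanifolds. *Constraint submanifold.* Put $C_0=J^1\pi$ and let $C_{i+1}$ be the set of $y\in C_i$ (with image $x\in M$) for which there is a linear map $h:T_xM\to T_yC_i$ that is a right inverse of the differential of $J^1\pi\to M$ and satisfies $\Omega_{\mathcal L}(h(u_1),\dots,h(u_m),w)=0$ for all $u_i\in T_xM$ and $w\in T_yJ^1\pi$. Assume that all $C_i$ are embedded submanifolds and that $C_{k+1}=C_k$ for some $k>0$, and put $N_f=C_k$. Let $\mathcal X^{N_f}$ be a locally decomposable $m$-vector field on $N_f$ with $i(\mathcal X^{N_f})\omega=1$ and $i(\mathcal X^{N_f})\Omega_{\mathcal L}=0$ along $N_f$ that projects under $\mathcal F\mathcal L$ onto an $m$-vector field $\mathcal X^{P_f}$ on $P_f=\mathcal F\mathcal L(N_f)$. *Submanifold of semi-holonomic points.* Let $S_f=\{x\in N_f: i(\mathcal X^{N_f})\mathcal V(x)=0\}$, assume that there is a smooth map $s_f:P_f\to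 N_f$ with $\mathcal F\mathcal L\circ s_f=\mathrm{Id}$ and $s_f(P_f)=S_f$, and let $\mathcal X^{S_f}$ be the $m$-vector field on $S_f$ with $\mathcal X^{S_f}\circ s_f=\Lambda^mTs_f\circ\mathcal X^{P_f}$. *Integrability submanifold.* Let $\mathcal I_1$ be the set of points of $S_f$ at which the distribution spanned by $\mathcal X^{S_f}$ is involutive (writing locally $\mathcal X^{S_f}=X_1\wedge\dots\wedge X_m$, the brackets $[X_\mu,X_\nu](x)$ lie in the span of $X_1(x),\dots,X_m(x)$), and $\mathcal I_{i+1}=\{x\in\mathcal I_i:\mathcal X^{S_f}(x)\in\Lambda^mT_x\mathcal I_i\}$. Assume that all $\mathcal I_i$ are embedded submanifolds and that $\mathcal I_{k+1}=\mathcal I_k$ for some $k$; put $\mathcal I_f=\mathcal I_k$ and $\mathcal X^{\mathcal I_f}=\mathcal X^{S_f}|_{\mathcal I_f}$. **Theorem.** Let $U\subseteq M$ be open and let $s:U\to\mathcal I_f$ be a smooth integral section of $\mathcal X^{\mathcal I_f}$, that is, a section of $J^1\pi\to M$ over $U$ such that for every $x\in U$ the image of $\Lambda^mT_xs$ is the line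 spanned by $\mathcal X^{\mathcal I_f}(s(x))$. Then there is a smooth section $\phi:U\to E$ of $\pi$ with $s=j^1\phi$, and $\phi$ is a solution of the Euler–Lagrange equations of $\mathcal L$: in all adapted coordinates $(x^\alpha,y^A)$, writing $\mathcal L=\hat L\,dx^1\wedge\dots\wedge dx^m$, $$\frac{\partial\hat L}{\partial y^A}\circ j^1\phi=\sum_{\alpha=1}^m\frac{\partial}{\partial x^\alpha}\Big(\frac{\partial\hat L}{\partial v^A_\alpha}\circ j^1\phi\Big)\qquad\text{for all }A .$$ -/

import Mathlib

open Set
open scoped Manifold ContDiff Topology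

noncomputable section

namespace FieldTheory

/-- The model `ℝᵐ` of the base manifold `M`, with coordinates `x^α`. -/
abbrev BaseModel (m : ℕ) := EuclideanSpace ℝ (Fin m)
/-- The model `ℝⁿ` of the fibres of `π : E → M`, with coordinates `y^A`. -/
abbrev FibModel (n : ℕ) := EuclideanSpace ℝ (Fin n)
/-- The model `ℝᵐ × ℝⁿ` of the configuration manifold `E`. -/
abbrev TotModel (m n : ℕ) := BaseModel m × FibModel n

section Charts

variable {M E : Type*} {m n : ℕ}
  [TopologicalSpace M] [ChartedSpace (BaseModel m) M]
  [TopologicalSpace E] [ChartedSpace (TotModel m n) E]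

/-- `π : E → M` is a smooth fibred manifold (a surjective submersion); every smooth fibre bundle
is one. -/
class IsFibredManifold (m n : ℕ) {M E : Type*}
    [TopologicalSpace M] [ChartedSpace (BaseModel m) M]
    [TopologicalSpace E] [ChartedSpace (TotModel m n) E] (π : E → M) : Prop where
  surjective : Function.Surjective π
  submersion : Manifold.IsSubmersion 𝓘(ℝ, TotModel m n) 𝓘(ℝ, BaseModel m) ∞ π

/-- A pair of charts of `E` and `M` in which `π` is `(x, y) ↦ x`. -/
structure AdaptedChart (m n : ℕ) {M E : Type*}
    [TopologicalSpace M] [ChartedSpace (BaseModel m) M]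
    [TopologicalSpace E] [ChartedSpace (TotModel m n) E] (π : E → M) where
  tot : OpenPartialHomeomorph E (TotModel m n)
  base : OpenPartialHomeomorph M (BaseModel m)
  tot_mem : tot ∈ IsManifold.maximalAtlas 𝓘(ℝ, TotModel m n) ∞ E
  base_mem : base ∈ IsManifold.maximalAtlas 𝓘(ℝ, BaseModel m) ∞ M
  mapsTo : MapsTo π tot.source base.source
  fst_eq : ∀ y ∈ tot.source, (tot y).1 = base (π y)

theorem exists_adaptedChart [IsManifold 𝓘(ℝ, TotModel m n) ∞ E] {π : E → M} (hπ : IsFibredManifold m n π) (y : E) :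
    ∃ a : AdaptedChart m n π, y ∈ a.tot.source := by
  obtain ⟨F, _, _, hF⟩ := hπ.submersion
  have h := hF y
  let e := h.equiv
  have hfF : FiniteDimensional ℝ F := by
    have : FiniteDimensional ℝ (BaseModel m × F) := e.toLinearEquiv.finiteDimensional
    exact Module.Finite.of_surjective (LinearMap.snd ℝ (BaseModel m) F) LinearMap.snd_surjective
  have hdim : Module.finrank ℝ F = Module.finrank ℝ (FibModel n) := by
    have := e.toLinearEquiv.finrank_eq
    rw [Module.finrank_prod, Module.finrank_prod] at this
    omega
  let k : F ≃L[ℝ] FibModel n := ContinuousLinearEquiv.ofFinrankEq hdim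
  let g : TotModel m n ≃L[ℝ] TotModel m n :=
    e.trans ((ContinuousLinearEquiv.refl ℝ (BaseModel m)).prodCongr k)
  have hg : ∀ z, (g z).1 = (e z).1 := fun z => rfl
  refine ⟨⟨h.domChart.transHomeomorph g.toHomeomorph, h.codChart, ?_, h.codChart_mem_maximalAtlas,
    ?_, ?_⟩, ?_⟩
  · rw [IsManifold.mem_maximalAtlas_iff_contMDiffOn]
    constructor
    · exact g.contDiff.contMDiff.comp_contMDiffOn
        (contMDiffOn_of_mem_maximalAtlas h.domChart_mem_maximalAtlas)
    · exact (contMDiffOn_symm_of_mem_maximalAtlas h.domChart_mem_maximalAtlas).comp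
        g.symm.contDiff.contMDiff.contMDiffOn (fun z hz => by simpa using hz)
  · intro z hz
    exact h.source_subset_preimage_source (by simpa using hz)
  · intro z hz
    have hz' : z ∈ h.domChart.source := by simpa using hz
    have hz2 : h.domChart z ∈ (h.domChart.extend 𝓘(ℝ, TotModel m n)).target := by
      simpa using h.domChart.map_source hz'
    have := h.writtenInCharts hz2
    simp [h.domChart.left_inv hz'] at this
    simpa [hg] using this.symm
  · simpa using h.mem_domChart_source

end Charts

section ChartDeriv

variable {V X : Type*} [NormedAddCommGroup V] [NormedSpace ℝ V]
  [TopologicalSpace X] [ChartedSpace V X]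

/-- The differential at `x` of a chart `e : X → V`. -/
def chartDeriv (e : OpenPartialHomeomorph X V) (x : X) : TangentSpace 𝓘(ℝ, V) x →L[ℝ] V :=
  mfderiv 𝓘(ℝ, V) 𝓘(ℝ, V) e x

variable {e e' : OpenPartialHomeomorph X V}

theorem chart_mdifferentiable (he : e ∈ IsManifold.maximalAtlas 𝓘(ℝ, V) ∞ X) :
    e.MDifferentiable 𝓘(ℝ, V) 𝓘(ℝ, V) :=
  ⟨(contMDiffOn_of_mem_maximalAtlas he).mdifferentiableOn (by simp),
    (contMDiffOn_symm_of_mem_maximalAtlas he).mdifferentiableOn (by simp)⟩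

theorem chartDeriv_isInvertible (he : e ∈ IsManifold.maximalAtlas 𝓘(ℝ, V) ∞ X) {x : X}
    (hx : x ∈ e.source) : (chartDeriv e x).IsInvertible :=
  ⟨(chart_mdifferentiable he).mfderiv hx, rfl⟩

theorem contDiffOn_transition (he : e ∈ IsManifold.maximalAtlas 𝓘(ℝ, V) ∞ X)
    (he' : e' ∈ IsManifold.maximalAtlas 𝓘(ℝ, V) ∞ X) :
    ContDiffOn ℝ ∞ (e' ∘ e.symm) (e.symm ≫ₕ e').source := by
  rw [← contMDiffOn_iff_contDiffOn]
  exact (contMDiffOn_of_mem_maximalAtlas he').comp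
    ((contMDiffOn_symm_of_mem_maximalAtlas he).mono (fun z hz => by simpa using hz.1))
    (fun z hz => by simpa using hz.2)

theorem contDiffOn_fderiv_transition (he : e ∈ IsManifold.maximalAtlas 𝓘(ℝ, V) ∞ X)
    (he' : e' ∈ IsManifold.maximalAtlas 𝓘(ℝ, V) ∞ X) :
    ContDiffOn ℝ ∞ (fderiv ℝ (e' ∘ e.symm)) (e.symm ≫ₕ e').source :=
  (contDiffOn_transition he he').fderiv_of_isOpen (e.symm ≫ₕ e').open_source (by simp)

theorem chartDeriv_transition (he : e ∈ IsManifold.maximalAtlas 𝓘(ℝ, V) ∞ X)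
    (he' : e' ∈ IsManifold.maximalAtlas 𝓘(ℝ, V) ∞ X) {x : X} (hx : x ∈ e.source)
    (hx' : x ∈ e'.source) :
    chartDeriv e' x = (fderiv ℝ (e' ∘ e.symm) (e x)).comp (chartDeriv e x) := by
  have hmem : e x ∈ (e.symm ≫ₕ e').source := by
    simp [hx, hx']
  have hd : DifferentiableAt ℝ (e' ∘ e.symm) (e x) :=
    ((contDiffOn_transition he he').differentiableOn (by simp)).differentiableAt
      ((e.symm ≫ₕ e').open_source.mem_nhds hmem)
  have h1 : HasMFDerivAt 𝓘(ℝ, V) 𝓘(ℝ, V) e x (mfderiv 𝓘(ℝ, V) 𝓘(ℝ, V) e x) :=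
    ((chart_mdifferentiable he).mdifferentiableAt hx).hasMFDerivAt
  have h2 := (hd.hasFDerivAt.hasMFDerivAt).comp x h1
  have h3 : (e' ∘ e.symm) ∘ e =ᶠ[𝓝 x] e' := by
    filter_upwards [e.open_source.mem_nhds hx] with z hz
    simp [hz]
  exact (h2.congr_of_eventuallyEq h3.symm).mfderiv

end ChartDeriv

section AdaptedCharts

variable {M E : Type*} {m n : ℕ}
  [TopologicalSpace M] [ChartedSpace (BaseModel m) M]
  [TopologicalSpace E] [ChartedSpace (TotModel m n) E] {π : E → M}

/-- The differential of the projection `π`. -/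
abbrev dproj (m n : ℕ) {M E : Type*}
    [TopologicalSpace M] [ChartedSpace (BaseModel m) M]
    [TopologicalSpace E] [ChartedSpace (TotModel m n) E] (π : E → M) (y : E) :
    TangentSpace 𝓘(ℝ, TotModel m n) y →L[ℝ] TangentSpace 𝓘(ℝ, BaseModel m) (π y) :=
  mfderiv 𝓘(ℝ, TotModel m n) 𝓘(ℝ, BaseModel m) π y

theorem AdaptedChart.chartDeriv_comp_dproj (hπ : IsFibredManifold m n π) (a : AdaptedChart m n π) {y : E} (hy : y ∈ a.tot.source) :
    (chartDeriv a.base (π y)).comp (dproj m n π y) =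
      (ContinuousLinearMap.fst ℝ (BaseModel m) (FibModel n)).comp (chartDeriv a.tot y) := by
  have hs : ContMDiff 𝓘(ℝ, TotModel m n) 𝓘(ℝ, BaseModel m) ∞ π := hπ.submersion.contMDiff
  have h1 : HasMFDerivAt 𝓘(ℝ, TotModel m n) 𝓘(ℝ, BaseModel m) π y (dproj m n π y) :=
    (hs.mdifferentiable (by simp) y).hasMFDerivAt
  have h2 := (((chart_mdifferentiable a.base_mem).mdifferentiableAt
    (a.mapsTo hy)).hasMFDerivAt).comp y h1
  have h3 := ((chart_mdifferentiable a.tot_mem).mdifferentiableAt hy).hasMFDerivAt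
  have h4 := ((ContinuousLinearMap.fst ℝ (BaseModel m) (FibModel n)).hasMFDerivAt (x := a.tot y)).comp y h3
  have h5 : a.base ∘ π =ᶠ[𝓝 y] (ContinuousLinearMap.fst ℝ (BaseModel m) (FibModel n)) ∘ a.tot := by
    filter_upwards [a.tot.open_source.mem_nhds hy] with z hz
    simp [a.fst_eq z hz]
  exact (hasMFDerivAt_unique (h2.congr_of_eventuallyEq h5.symm) h4)

end AdaptedCharts

section FibreCoords

variable {m n : ℕ} {M E : Type*}
  [TopologicalSpace M] [ChartedSpace (BaseModel m) M]
  [TopologicalSpace E] [ChartedSpace (TotModel m n) E]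

/-- Data turning a set `Q` over `E` into a smooth bundle over `E` with typical fibre `F`: over every
adapted chart `a` a fibre coordinate `coord a` with inverse `glue a`, and smooth transitions. -/
structure FibreCoords (m n : ℕ) {M E : Type*}
    [TopologicalSpace M] [ChartedSpace (BaseModel m) M]
    [TopologicalSpace E] [ChartedSpace (TotModel m n) E]
    (π : E → M) (Q F : Type*) [NormedAddCommGroup F] [NormedSpace ℝ F] where
  proj : Q → E
  coord : AdaptedChart m n π → Q → F
  glue : ∀ (a : AdaptedChart m n π) (y : E), y ∈ a.tot.source → F → Q
  trans : AdaptedChart m n π → AdaptedChart m n π → TotModel m n → F → F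
  proj_glue : ∀ a y hy v, proj (glue a y hy v) = y
  coord_glue : ∀ a y hy v, coord a (glue a y hy v) = v
  glue_coord : ∀ a q (hq : proj q ∈ a.tot.source), glue a (proj q) hq (coord a q) = q
  coord_trans : ∀ a b q, proj q ∈ a.tot.source → proj q ∈ b.tot.source →
    coord b q = trans a b (a.tot (proj q)) (coord a q)
  contDiffOn_trans : ∀ a b, ContDiffOn ℝ ∞ (fun z : TotModel m n × F => trans a b z.1 z.2)
    ((a.tot.symm ≫ₕ b.tot).source ×ˢ univ)

variable {π : E → M} {Q F : Type*} [NormedAddCommGroup F] [NormedSpace ℝ F]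

namespace FibreCoords

open Classical in
/-- The bundle chart `q ↦ (a.tot (proj q), coord a q)` over the adapted chart `a`. The point `q₀`
only serves as the value of the inverse outside the target. -/
def chart (c : FibreCoords m n π Q F) (a : AdaptedChart m n π) (q₀ : Q) :
    PartialEquiv Q (TotModel m n × F) where
  toFun q := (a.tot (c.proj q), c.coord a q)
  invFun z := if h : z.1 ∈ a.tot.target
    then c.glue a (a.tot.symm z.1) (a.tot.map_target h) z.2 else q₀
  source := c.proj ⁻¹' a.tot.source
  target := a.tot.target ×ˢ univ
  map_source' q hq := ⟨a.tot.map_source hq, mem_univ _⟩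
  map_target' z hz := by
    simp only [mem_preimage]
    rw [dif_pos hz.1, c.proj_glue]
    exact a.tot.map_target hz.1
  left_inv' q hq := by
    have h : a.tot (c.proj q) ∈ a.tot.target := a.tot.map_source hq
    rw [dif_pos h]
    have key : ∀ y (hy : y ∈ a.tot.source), y = c.proj q → c.glue a y hy (c.coord a q) = q := by
      rintro y hy rfl
      exact c.glue_coord a q hy
    exact key _ _ (a.tot.left_inv hq)
  right_inv' z hz := by
    rw [dif_pos hz.1, c.proj_glue, c.coord_glue, a.tot.right_inv hz.1]

theorem chart_trans_source (c : FibreCoords m n π Q F) (a b : AdaptedChart m n π) (q₀ q₁ : Q) :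
    ((c.chart a q₀).symm.trans (c.chart b q₁)).source =
      (a.tot.symm ≫ₕ b.tot).source ×ˢ univ := by
  ext z
  simp only [PartialEquiv.trans_source, PartialEquiv.symm_source, mem_inter_iff, mem_preimage,
    mem_prod, mem_univ, and_true, OpenPartialHomeomorph.trans_source,
    OpenPartialHomeomorph.symm_source]
  constructor
  · rintro ⟨h1, h2⟩
    have h1' : z.1 ∈ a.tot.target := h1.1
    refine ⟨h1', ?_⟩
    have h2' : c.proj ((c.chart a q₀).symm z) ∈ b.tot.source := h2
    have : (c.chart a q₀).symm z = c.glue a (a.tot.symm z.1) (a.tot.map_target h1') z.2 :=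
      dif_pos h1'
    rwa [this, c.proj_glue] at h2'
  · rintro ⟨h1, h2⟩
    refine ⟨⟨h1, mem_univ _⟩, ?_⟩
    change c.proj ((c.chart a q₀).symm z) ∈ b.tot.source
    have : (c.chart a q₀).symm z = c.glue a (a.tot.symm z.1) (a.tot.map_target h1) z.2 :=
      dif_pos h1
    rwa [this, c.proj_glue]

theorem contDiffOn_chart_trans (c : FibreCoords m n π Q F) (a b : AdaptedChart m n π) (q₀ q₁ : Q) :
    ContDiffOn ℝ ∞ ((c.chart a q₀).symm.trans (c.chart b q₁))
      ((c.chart a q₀).symm.trans (c.chart b q₁)).source := by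
  rw [chart_trans_source]
  have h : ContDiffOn ℝ ∞ (fun z : TotModel m n × F =>
      (((b.tot ∘ a.tot.symm) z.1, c.trans a b z.1 z.2) : TotModel m n × F))
      ((a.tot.symm ≫ₕ b.tot).source ×ˢ univ) :=
    ((contDiffOn_transition a.tot_mem b.tot_mem).comp contDiffOn_fst (fun z hz => hz.1)).prodMk
      (c.contDiffOn_trans a b)
  refine h.congr ?_
  rintro z ⟨hz, -⟩
  have hz1 : z.1 ∈ a.tot.target := by simpa using hz.1
  have hz2 : a.tot.symm z.1 ∈ b.tot.source := by simpa using hz.2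
  have : (c.chart a q₀).symm z = c.glue a (a.tot.symm z.1) (a.tot.map_target hz1) z.2 :=
    dif_pos hz1
  change (b.tot (c.proj ((c.chart a q₀).symm z)), c.coord b ((c.chart a q₀).symm z)) = _
  rw [this, c.proj_glue, c.coord_trans a b _ (by rw [c.proj_glue]; exact a.tot.map_target hz1)
    (by rw [c.proj_glue]; exact hz2), c.proj_glue, c.coord_glue, a.tot.right_inv hz1]
  rfl

variable [IsManifold 𝓘(ℝ, TotModel m n) ∞ E]

/-- The charted space structure on `Q` given by the bundle charts. -/
def core (hπ : IsFibredManifold m n π) (c : FibreCoords m n π Q F) :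
    ChartedSpaceCore (TotModel m n × F) Q where
  atlas := range fun p : AdaptedChart m n π × Q => c.chart p.1 p.2
  chartAt q := c.chart (exists_adaptedChart hπ (c.proj q)).choose q
  mem_chart_source q := (exists_adaptedChart hπ (c.proj q)).choose_spec
  chart_mem_atlas q := ⟨(_, q), rfl⟩
  open_source := by
    rintro _ _ ⟨p, rfl⟩ ⟨p', rfl⟩
    rw [chart_trans_source]
    exact (OpenPartialHomeomorph.open_source _).prod isOpen_univ
  continuousOn_toFun := by
    rintro _ _ ⟨p, rfl⟩ ⟨p', rfl⟩
    exact (c.contDiffOn_chart_trans _ _ _ _).continuousOn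

theorem isManifold_core (hπ : IsFibredManifold m n π) (c : FibreCoords m n π Q F) :
    @IsManifold ℝ _ _ _ _ _ _ 𝓘(ℝ, TotModel m n × F) ∞ Q (c.core hπ).toTopologicalSpace
      (c.core hπ).toChartedSpace := by
  let _ := (c.core hπ).toTopologicalSpace
  let _ := (c.core hπ).toChartedSpace
  refine isManifold_of_contDiffOn _ _ _ ?_
  intro e e' he he'
  obtain ⟨_, ⟨f, rfl⟩, hf⟩ := he
  obtain ⟨_, ⟨f', rfl⟩, hf'⟩ := he'
  simp only [mem_iUnion, mem_singleton_iff] at hf hf'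
  obtain ⟨⟨p, rfl⟩, rfl⟩ := hf
  obtain ⟨⟨p', rfl⟩, rfl⟩ := hf'
  simpa using! c.contDiffOn_chart_trans p.1 p'.1 p.2 p'.2

end FibreCoords

end FibreCoords

section JetBundle

variable {m n : ℕ} {M E : Type*}
  [TopologicalSpace M] [ChartedSpace (BaseModel m) M]
  [TopologicalSpace E] [ChartedSpace (TotModel m n) E]

/-- A point of the first jet bundle `J¹π`: a point `y` of `E` and a linear map
`T_{π y} M → T_y E` that is a right inverse of `T_y π`. -/
structure Jet (m n : ℕ) {M E : Type*}
    [TopologicalSpace M] [ChartedSpace (BaseModel m) M]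
    [TopologicalSpace E] [ChartedSpace (TotModel m n) E] (π : E → M) where
  pt : E
  hor : TangentSpace 𝓘(ℝ, BaseModel m) (π pt) →L[ℝ] TangentSpace 𝓘(ℝ, TotModel m n) pt
  dproj_comp_hor : (dproj m n π pt).comp hor = ContinuousLinearMap.id ℝ _

/-- `Hom (T_{π y} M, V_y π)`, as the linear maps `A : T_{π y} M → T_y E` with `Tπ ∘ A = 0`. It is the
space of translations of the fibre of `J¹π` over `y`. -/
abbrev VertHom (m n : ℕ) {M E : Type*}
    [TopologicalSpace M] [ChartedSpace (BaseModel m) M]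
    [TopologicalSpace E] [ChartedSpace (TotModel m n) E] (π : E → M) (y : E) :
    Submodule ℝ
      (TangentSpace 𝓘(ℝ, BaseModel m) (π y) →L[ℝ] TangentSpace 𝓘(ℝ, TotModel m n) y) :=
  LinearMap.ker (ContinuousLinearMap.postcomp (TangentSpace 𝓘(ℝ, BaseModel m) (π y)) (dproj m n π y)).toLinearMap

/-- A point of the restricted multimomentum bundle `J¹π*`: a point `y` of `E` and a linear form on
`Hom (T_{π y} M, V_y π)`. A volume form `η` identifies this fibre with
`Λᵐ₂ T*_y E / π* Λᵐ T*_{π y} M`, the class of `ξ` acting on `A` by the number `c` such that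
`∑ i, ξ (h e₁, …, A e_i, …, h e_m) = c * η (e₁, …, e_m)` for any lift `h` of `T_{π y} M` to `T_y E`. -/
structure Momentum (m n : ℕ) {M E : Type*}
    [TopologicalSpace M] [ChartedSpace (BaseModel m) M]
    [TopologicalSpace E] [ChartedSpace (TotModel m n) E] (π : E → M) where
  pt : E
  mom : Module.Dual ℝ (VertHom m n π pt)

/-- The space of the fibre coordinates `v^A_α` of `J¹π`. -/
abbrev JetFib (m n : ℕ) := BaseModel m →L[ℝ] FibModel n
/-- The space of the fibre coordinates `p^α_A` of `J¹π*`. -/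
abbrev MomFib (m n : ℕ) := JetFib m n →L[ℝ] ℝ

variable {π : E → M}

theorem VertHom.mem_iff {y : E} (A : TangentSpace 𝓘(ℝ, BaseModel m) (π y) →L[ℝ] TangentSpace 𝓘(ℝ, TotModel m n) y) : A ∈ VertHom m n π y ↔ (dproj m n π y).comp A = 0 := Iff.rfl

namespace AdaptedChart

variable (a b : AdaptedChart m n π)

/-- The linear map `T_{π y} M → T_y E` with coordinate expression `u ↦ (α u, v u)`. -/
def toTangent (y : E) (α : BaseModel m →L[ℝ] BaseModel m) (v : JetFib m n) :
    TangentSpace 𝓘(ℝ, BaseModel m) (π y) →L[ℝ] TangentSpace 𝓘(ℝ, TotModel m n) y :=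
  (chartDeriv a.tot y).inverse.comp
    ((ContinuousLinearMap.inl ℝ (BaseModel m) (FibModel n) ∘L α +
      ContinuousLinearMap.inr ℝ (BaseModel m) (FibModel n) ∘L v).comp (chartDeriv a.base (π y)))

/-- The fibre coordinates of `A : T_{π y} M → T_y E`: the `y`-part of the coordinate expression. -/
def ofTangent (y : E)
    (A : TangentSpace 𝓘(ℝ, BaseModel m) (π y) →L[ℝ] TangentSpace 𝓘(ℝ, TotModel m n) y) :
    JetFib m n :=
  (ContinuousLinearMap.snd ℝ (BaseModel m) (FibModel n)).comp
    ((chartDeriv a.tot y).comp (A.comp (chartDeriv a.base (π y)).inverse))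

theorem ofTangent_toTangent {y : E} (hy : y ∈ a.tot.source) (α : BaseModel m →L[ℝ] BaseModel m)
    (v : JetFib m n) : a.ofTangent y (a.toTangent y α v) = v := by
  have h1 := chartDeriv_isInvertible a.tot_mem hy
  have h2 := chartDeriv_isInvertible a.base_mem (a.mapsTo hy)
  ext u
  simp [ofTangent, toTangent, h1, h2]


theorem dproj_comp_toTangent (hπ : IsFibredManifold m n π) {y : E} (hy : y ∈ a.tot.source)
    (α : BaseModel m →L[ℝ] BaseModel m) (v : JetFib m n) :
    (dproj m n π y).comp (a.toTangent y α v) =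
      (chartDeriv a.base (π y)).inverse.comp (α.comp (chartDeriv a.base (π y))) := by
  have h1 := chartDeriv_isInvertible a.tot_mem hy
  have h2 := chartDeriv_isInvertible a.base_mem (a.mapsTo hy)
  ext u
  have h3 := DFunLike.congr_fun (a.chartDeriv_comp_dproj hπ hy) (a.toTangent y α v u)
  simp only [ContinuousLinearMap.comp_apply] at h3 ⊢
  rw [eq_comm, h2.inverse_apply_eq, h3]
  simp [toTangent, h1]

theorem toTangent_ofTangent (hπ : IsFibredManifold m n π) {y : E} (hy : y ∈ a.tot.source)
    (α : BaseModel m →L[ℝ] BaseModel m)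
    (A : TangentSpace 𝓘(ℝ, BaseModel m) (π y) →L[ℝ] TangentSpace 𝓘(ℝ, TotModel m n) y)
    (hA : (dproj m n π y).comp A =
      (chartDeriv a.base (π y)).inverse.comp (α.comp (chartDeriv a.base (π y)))) :
    a.toTangent y α (a.ofTangent y A) = A := by
  have h1 := chartDeriv_isInvertible a.tot_mem hy
  have h2 := chartDeriv_isInvertible a.base_mem (a.mapsTo hy)
  ext u
  have h3 := DFunLike.congr_fun (a.chartDeriv_comp_dproj hπ hy) (A u)
  have h4 := DFunLike.congr_fun hA u
  simp only [ContinuousLinearMap.comp_apply] at h3 h4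
  rw [h4] at h3
  simp only [toTangent, ContinuousLinearMap.comp_apply]
  rw [h1.inverse_apply_eq]
  refine Prod.ext ?_ ?_
  · simpa [h2] using h3
  · simp [ofTangent, h2]

/-- The change of coordinates for linear maps `T_{π y} M → T_y E` with coordinate expression
`u ↦ (α u, v u)`. -/
def jetTrans (z : TotModel m n) (α : BaseModel m →L[ℝ] BaseModel m) (v : JetFib m n) :
    JetFib m n :=
  (ContinuousLinearMap.snd ℝ (BaseModel m) (FibModel n)).comp
    ((fderiv ℝ (b.tot ∘ a.tot.symm) z).comp
      ((ContinuousLinearMap.inl ℝ (BaseModel m) (FibModel n) ∘L α +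
        ContinuousLinearMap.inr ℝ (BaseModel m) (FibModel n) ∘L v).comp
          (fderiv ℝ (a.base ∘ b.base.symm) ((b.tot ∘ a.tot.symm) z).1)))

theorem ofTangent_eq_jetTrans {y : E} (hy : y ∈ a.tot.source)
    (hy' : y ∈ b.tot.source) (α : BaseModel m →L[ℝ] BaseModel m) (v : JetFib m n) :
    b.ofTangent y (a.toTangent y α v) = jetTrans a b (a.tot y) α v := by
  have h1 := chartDeriv_isInvertible a.tot_mem hy
  have h2 := chartDeriv_isInvertible b.base_mem (b.mapsTo hy')
  have h3 := chartDeriv_transition a.tot_mem b.tot_mem hy hy'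
  have h4 := chartDeriv_transition b.base_mem a.base_mem (b.mapsTo hy') (a.mapsTo hy)
  have h5 : ((b.tot ∘ a.tot.symm) (a.tot y)).1 = b.base (π y) := by
    simp [a.tot.left_inv hy, b.fst_eq y hy']
  ext1 u
  simp only [ofTangent, toTangent, jetTrans, ContinuousLinearMap.comp_apply, h3, h4, h5]
  simp [h1, h2]

theorem contDiffOn_jetTrans (α : BaseModel m →L[ℝ] BaseModel m) :
    ContDiffOn ℝ ∞ (fun z : TotModel m n × JetFib m n => jetTrans a b z.1 α z.2)
      ((a.tot.symm ≫ₕ b.tot).source ×ˢ univ) := by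
  have hF : ContDiffOn ℝ ∞ (fun z : TotModel m n × JetFib m n =>
      fderiv ℝ (b.tot ∘ a.tot.symm) z.1) ((a.tot.symm ≫ₕ b.tot).source ×ˢ univ) :=
    (contDiffOn_fderiv_transition a.tot_mem b.tot_mem).comp contDiffOn_fst (fun z hz => hz.1)
  have hG : ContDiffOn ℝ ∞ (fun z : TotModel m n × JetFib m n =>
      fderiv ℝ (a.base ∘ b.base.symm) ((b.tot ∘ a.tot.symm) z.1).1)
      ((a.tot.symm ≫ₕ b.tot).source ×ˢ univ) := by
    refine (contDiffOn_fderiv_transition b.base_mem a.base_mem).comp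
      (contDiff_fst.comp_contDiffOn
        ((contDiffOn_transition a.tot_mem b.tot_mem).comp contDiffOn_fst (fun z hz => hz.1))) ?_
    rintro z ⟨hz, -⟩
    have hz1 : z.1 ∈ a.tot.target := by simpa using hz.1
    have hz2 : a.tot.symm z.1 ∈ b.tot.source := by simpa using hz.2
    have h5 : ((b.tot ∘ a.tot.symm) z.1).1 = b.base (π (a.tot.symm z.1)) := b.fst_eq _ hz2
    simp only [h5, OpenPartialHomeomorph.trans_source, OpenPartialHomeomorph.symm_source,
      mem_inter_iff, mem_preimage]
    refine ⟨b.base.map_source (b.mapsTo hz2), ?_⟩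
    rw [b.base.left_inv (b.mapsTo hz2)]
    exact a.mapsTo (a.tot.map_target hz1)
  have hv : ContDiff ℝ ∞ (fun z : TotModel m n × JetFib m n =>
      ContinuousLinearMap.inl ℝ (BaseModel m) (FibModel n) ∘L α +
        ContinuousLinearMap.inr ℝ (BaseModel m) (FibModel n) ∘L z.2) :=
    contDiff_const.add (contDiff_const.clm_comp contDiff_snd)
  exact contDiffOn_const.clm_comp (hF.clm_comp (hv.contDiffOn.clm_comp hG))

end AdaptedChart

/-- Coordinates `v^A_α` on `J¹π`. -/
def jetCoords (hπ : IsFibredManifold m n π) : FibreCoords m n π (Jet m n π) (JetFib m n) where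
  proj := Jet.pt
  coord a j := a.ofTangent j.pt j.hor
  glue a y hy v := ⟨y, a.toTangent y (.id ℝ _) v, by
    rw [a.dproj_comp_toTangent hπ hy]
    have h2 := chartDeriv_isInvertible a.base_mem (a.mapsTo hy)
    ext1 u
    simp [h2]⟩
  trans a b z v := AdaptedChart.jetTrans a b z (.id ℝ _) v
  proj_glue _ _ _ _ := rfl
  coord_glue a y hy v := a.ofTangent_toTangent hy _ v
  glue_coord a q hq := by
    obtain ⟨y, h, hh⟩ := q
    congr 1
    refine a.toTangent_ofTangent hπ hq _ _ ?_
    have h2 := chartDeriv_isInvertible a.base_mem (a.mapsTo hq)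
    rw [hh]
    ext1 u
    simp [h2]
  coord_trans a b q hq hq' := by
    rw [← a.ofTangent_eq_jetTrans b hq hq', a.toTangent_ofTangent hπ hq]
    have h2 := chartDeriv_isInvertible a.base_mem (a.mapsTo hq)
    rw [q.dproj_comp_hor]
    ext1 u
    simp [h2]
  contDiffOn_trans a b := a.contDiffOn_jetTrans b _

namespace AdaptedChart

variable (a b : AdaptedChart m n π)

theorem toTangent_mem_vertHom (hπ : IsFibredManifold m n π) {y : E} (hy : y ∈ a.tot.source)
    (v : JetFib m n) : a.toTangent y 0 v ∈ VertHom m n π y := by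
  rw [VertHom.mem_iff, a.dproj_comp_toTangent hπ hy]
  simp

/-- The vertical linear map with coordinates `v`. -/
def toVertHom (hπ : IsFibredManifold m n π) (y : E) (hy : y ∈ a.tot.source) :
    JetFib m n →ₗ[ℝ] VertHom m n π y where
  toFun v := ⟨a.toTangent y 0 v, a.toTangent_mem_vertHom hπ hy v⟩
  map_add' v w := by
    ext u
    simp [toTangent]
  map_smul' r v := by
    ext u
    simp [toTangent]

/-- The coordinates of a vertical linear map. -/
def ofVertHom (y : E) : VertHom m n π y →ₗ[ℝ] JetFib m n where
  toFun A := a.ofTangent y A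
  map_add' v w := by
    ext u
    simp [ofTangent]
  map_smul' r v := by
    ext u
    simp [ofTangent]

theorem ofVertHom_toVertHom (hπ : IsFibredManifold m n π) {y : E} (hy : y ∈ a.tot.source)
    (v : JetFib m n) : a.ofVertHom y (a.toVertHom hπ y hy v) = v :=
  a.ofTangent_toTangent hy 0 v

theorem toVertHom_ofVertHom (hπ : IsFibredManifold m n π) {y : E} (hy : y ∈ a.tot.source)
    (A : VertHom m n π y) : a.toVertHom hπ y hy (a.ofVertHom y A) = A :=
  Subtype.ext (a.toTangent_ofTangent hπ hy 0 A (by rw [(VertHom.mem_iff _).1 A.2]; simp))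

/-- The linear part of the transition of jet coordinates, as a continuous linear map. -/
def jetTransL (z : TotModel m n) : JetFib m n →L[ℝ] JetFib m n :=
  (ContinuousLinearMap.compL ℝ (BaseModel m) (FibModel n) (FibModel n)
    ((ContinuousLinearMap.snd ℝ (BaseModel m) (FibModel n)).comp
      ((fderiv ℝ (b.tot ∘ a.tot.symm) z).comp
        (ContinuousLinearMap.inr ℝ (BaseModel m) (FibModel n))))).comp
  ((ContinuousLinearMap.compL ℝ (BaseModel m) (BaseModel m) (FibModel n)).flip
    (fderiv ℝ (a.base ∘ b.base.symm) ((b.tot ∘ a.tot.symm) z).1))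

theorem jetTransL_apply (z : TotModel m n) (v : JetFib m n) :
    jetTransL a b z v = jetTrans a b z 0 v := by
  ext1 u
  simp [jetTransL, jetTrans]

end AdaptedChart

open Classical in
/-- Coordinates `p^α_A` on `J¹π*`. -/
def momentumCoords (hπ : IsFibredManifold m n π) :
    FibreCoords m n π (Momentum m n π) (MomFib m n) where
  proj := Momentum.pt
  coord a p := if h : p.pt ∈ a.tot.source then
    LinearMap.toContinuousLinearMap (p.mom ∘ₗ a.toVertHom hπ p.pt h) else 0
  glue a y _ P := ⟨y, P.toLinearMap ∘ₗ a.ofVertHom y⟩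
  trans a b z P := P.comp (AdaptedChart.jetTransL b a ((b.tot ∘ a.tot.symm) z))
  proj_glue _ _ _ _ := rfl
  coord_glue a y hy P := by
    rw [dif_pos hy]
    ext v
    simp [a.ofVertHom_toVertHom hπ hy]
  glue_coord a p hp := by
    rw [dif_pos hp]
    obtain ⟨y, p⟩ := p
    congr 1
    ext A
    simp [a.toVertHom_ofVertHom hπ hp]
  coord_trans a b p hp hp' := by
    rw [dif_pos hp, dif_pos hp']
    ext v
    have h1 : (b.tot ∘ a.tot.symm) (a.tot p.pt) = b.tot p.pt := by simp [a.tot.left_inv hp]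
    simp only [LinearMap.coe_toContinuousLinearMap', LinearMap.comp_apply,
      ContinuousLinearMap.comp_apply, h1, AdaptedChart.jetTransL_apply]
    rw [← b.ofTangent_eq_jetTrans a hp' hp]
    congr 1
    exact (a.toVertHom_ofVertHom hπ hp (b.toVertHom hπ p.pt hp' v)).symm
  contDiffOn_trans a b := by
    refine contDiffOn_snd.clm_comp ?_
    have hmaps : MapsTo (b.tot ∘ a.tot.symm) (a.tot.symm ≫ₕ b.tot).source
        (b.tot.symm ≫ₕ a.tot).source := by
      intro z hz
      have hz1 : z ∈ a.tot.target := by simpa using hz.1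
      have hz2 : a.tot.symm z ∈ b.tot.source := by simpa using hz.2
      simp [hz2, hz1]
    have hba : ContDiffOn ℝ ∞ (AdaptedChart.jetTransL b a) (b.tot.symm ≫ₕ a.tot).source := by
      have hF := contDiffOn_fderiv_transition b.tot_mem a.tot_mem
      have hG : ContDiffOn ℝ ∞ (fun z : TotModel m n =>
          fderiv ℝ (b.base ∘ a.base.symm) ((a.tot ∘ b.tot.symm) z).1)
          (b.tot.symm ≫ₕ a.tot).source := by
        refine (contDiffOn_fderiv_transition a.base_mem b.base_mem).comp
          (contDiff_fst.comp_contDiffOn (contDiffOn_transition b.tot_mem a.tot_mem)) ?_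
        intro z hz
        have hz1 : z ∈ b.tot.target := by simpa using hz.1
        have hz2 : b.tot.symm z ∈ a.tot.source := by simpa using hz.2
        have h5 : ((a.tot ∘ b.tot.symm) z).1 = a.base (π (b.tot.symm z)) := a.fst_eq _ hz2
        simp only [h5, OpenPartialHomeomorph.trans_source, OpenPartialHomeomorph.symm_source,
          mem_inter_iff, mem_preimage]
        refine ⟨a.base.map_source (a.mapsTo hz2), ?_⟩
        rw [a.base.left_inv (a.mapsTo hz2)]
        exact b.mapsTo (b.tot.map_target hz1)
      exact (contDiffOn_const.clm_apply
        (contDiffOn_const.clm_comp (hF.clm_comp contDiffOn_const))).clm_comp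
        (contDiffOn_const.clm_apply hG)
    exact (hba.comp (contDiffOn_transition a.tot_mem b.tot_mem) hmaps).comp contDiffOn_fst
      (fun z hz => hz.1)

section Instances

variable [IsManifold 𝓘(ℝ, TotModel m n) ∞ E] [hπ : IsFibredManifold m n π]

/-- The topology, the atlas and the smooth structure of `J¹π` given by the coordinates
`(x^α, y^A, v^A_α)`, and below those of `J¹π*` given by `(x^α, y^A, p^α_A)`. -/
instance : TopologicalSpace (Jet m n π) := ((jetCoords hπ).core hπ).toTopologicalSpace
instance : ChartedSpace (TotModel m n × JetFib m n) (Jet m n π) :=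
  ((jetCoords hπ).core hπ).toChartedSpace
instance : IsManifold 𝓘(ℝ, TotModel m n × JetFib m n) ∞ (Jet m n π) :=
  (jetCoords hπ).isManifold_core hπ

instance : TopologicalSpace (Momentum m n π) := ((momentumCoords hπ).core hπ).toTopologicalSpace
instance : ChartedSpace (TotModel m n × MomFib m n) (Momentum m n π) :=
  ((momentumCoords hπ).core hπ).toChartedSpace
instance : IsManifold 𝓘(ℝ, TotModel m n × MomFib m n) ∞ (Momentum m n π) :=
  (momentumCoords hπ).isManifold_core hπ

end Instances

end JetBundle

section Multilinear

open Function in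
/-- The alternating map `w ↦ ∑ i, α (T w₁, …, u, …, T wₘ) • P (w i)`, with `u` in the `i`-th slot. -/
def insertSum {ι V B F : Type*} [Fintype ι] [dι : DecidableEq ι]
    [AddCommGroup V] [Module ℝ V] [AddCommGroup B] [Module ℝ B] [AddCommGroup F] [Module ℝ F]
    (α : B [⋀^ι]→ₗ[ℝ] ℝ) (T : V →ₗ[ℝ] B) (P : V →ₗ[ℝ] F) (u : B) : V [⋀^ι]→ₗ[ℝ] F where
  toFun w := ∑ i, α (update (T ∘ w) i u) • P (w i)
  map_update_add' {inst} w i x y := by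
    cases Subsingleton.elim inst dι
    rw [← Finset.sum_add_distrib]
    refine Finset.sum_congr rfl fun k _ => ?_
    by_cases hk : k = i
    · subst hk
      simp [Function.comp_update]
    · simp [hk, Function.comp_update, update_comm (Ne.symm hk), add_smul]
  map_update_smul' {inst} w i c x := by
    cases Subsingleton.elim inst dι
    rw [Finset.smul_sum]
    refine Finset.sum_congr rfl fun k _ => ?_
    by_cases hk : k = i
    · subst hk
      simp [Function.comp_update, smul_comm c]
    · simp [hk, Function.comp_update, update_comm (Ne.symm hk), mul_smul]
  map_eq_zero_of_eq' w a b hab hne := by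
    have h0 : ∀ k, k ≠ a → k ≠ b → α (update (T ∘ w) k u) • P (w k) = 0 := by
      intro k ha hb
      rw [α.map_eq_zero_of_eq _ (i := a) (j := b) ?_ hne, zero_smul]
      simp [Ne.symm ha, Ne.symm hb, hab]
    rw [← Finset.sum_subset (Finset.subset_univ {a, b}) (fun k _ hk => by
      simp only [Finset.mem_insert, Finset.mem_singleton, not_or] at hk
      exact h0 k hk.1 hk.2), Finset.sum_pair hne]
    have h1 : update (T ∘ w) b u = update (T ∘ w) a u ∘ Equiv.swap a b := by
      ext k
      by_cases ha : k = a
      · subst ha; simp [hne, hne.symm, hab]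
      · by_cases hb : k = b
        · subst hb; simp
        · simp [Equiv.swap_apply_of_ne_of_ne ha hb, ha, hb]
    rw [h1, α.map_swap _ hne, hab]
    simp

open Function in
theorem insertSum_apply {ι V B F : Type*} [Fintype ι] [DecidableEq ι]
    [AddCommGroup V] [Module ℝ V] [AddCommGroup B] [Module ℝ B] [AddCommGroup F] [Module ℝ F]
    (α : B [⋀^ι]→ₗ[ℝ] ℝ) (T : V →ₗ[ℝ] B) (P : V →ₗ[ℝ] F) (u : B) (w : ι → V) :
    insertSum α T P u w = ∑ i, α (update (T ∘ w) i u) • P (w i) := rfl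

theorem continuous_alternatingMap {k : ℕ} {V : Type*} [AddCommGroup V] [Module ℝ V]
    [TopologicalSpace V] [IsTopologicalAddGroup V] [ContinuousSMul ℝ V] [T2Space V]
    [FiniteDimensional ℝ V] (f : V [⋀^Fin k]→ₗ[ℝ] ℝ) : Continuous f := by
  let b := Module.finBasis ℝ V
  have h : ∀ w : Fin k → V, f w = ∑ r : Fin k → Fin (Module.finrank ℝ V),
      (∏ i, b.coord (r i) (w i)) • f (fun i => b (r i)) := by
    intro w
    have hw : w = fun i => ∑ l, b.coord l (w i) • b l := by
      ext i
      simp [b.sum_repr]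
    conv_lhs => rw [hw]
    have := f.toMultilinearMap.map_sum (fun (i : Fin k) l => b.coord l (w i) • b l)
    refine this.trans (Finset.sum_congr rfl fun r _ => ?_)
    exact f.toMultilinearMap.map_smul_univ _ _
  have h' : (f : (Fin k → V) → ℝ) = fun w => ∑ r : Fin k → Fin (Module.finrank ℝ V),
      (∏ i, b.coord (r i) (w i)) • f (fun i => b (r i)) := funext h
  rw [h']
  refine continuous_finsetSum _ fun r _ => ?_
  have h2 : Continuous fun w : Fin k → V => ∏ i, b.coord (r i) (w i) :=
    continuous_finsetProd _ fun i _ =>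
      (b.coord (r i)).continuous_of_finiteDimensional.comp (continuous_apply i)
  exact h2.mul continuous_const

end Multilinear

section Forms

variable {k : ℕ} {V X : Type*} [NormedAddCommGroup V] [NormedSpace ℝ V]
  [TopologicalSpace X] [ChartedSpace V X]

/-- The exterior derivative of a differential `k`-form `Φ` on a manifold: at `x` it is computed in the
preferred chart at `x`. -/
def extDerivManifold (Φ : ∀ x : X, TangentSpace 𝓘(ℝ, V) x [⋀^Fin k]→L[ℝ] ℝ) (x : X) :
    TangentSpace 𝓘(ℝ, V) x [⋀^Fin (k + 1)]→L[ℝ] ℝ :=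
  (extDeriv (fun z : V => (Φ ((chartAt V x).symm z)).compContinuousLinearMap
      (mfderiv 𝓘(ℝ, V) 𝓘(ℝ, V) (chartAt V x).symm z)) (chartAt V x x)).compContinuousLinearMap
    (chartDeriv (chartAt V x) x)

variable [FiniteDimensional ℝ V]

/-- An alternating form on a (finite-dimensional) tangent space is continuous. -/
def toContinuousForm {x : X} (f : TangentSpace 𝓘(ℝ, V) x [⋀^Fin k]→ₗ[ℝ] ℝ) :
    TangentSpace 𝓘(ℝ, V) x [⋀^Fin k]→L[ℝ] ℝ :=
  { f with
    cont := by
      have : T2Space (TangentSpace 𝓘(ℝ, V) x) := inferInstanceAs (T2Space V)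
      have : FiniteDimensional ℝ (TangentSpace 𝓘(ℝ, V) x) := inferInstanceAs (FiniteDimensional ℝ V)
      exact continuous_alternatingMap f }

end Forms

section Lagrangian

variable {m n : ℕ} {M E : Type*}
  [TopologicalSpace M] [ChartedSpace (BaseModel m) M]
  [TopologicalSpace E] [ChartedSpace (TotModel m n) E] {π : E → M}

/-- The model of `J¹π`. -/
abbrev JetModel (m n : ℕ) := TotModel m n × JetFib m n
/-- The model of `J¹π*`. -/
abbrev MomModel (m n : ℕ) := TotModel m n × MomFib m n

/-- Differential `m`-forms on `M`, without regularity. -/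
abbrev BaseForm (m : ℕ) (M : Type*) [TopologicalSpace M] [ChartedSpace (BaseModel m) M] :=
  ∀ x : M, TangentSpace 𝓘(ℝ, BaseModel m) x [⋀^Fin m]→L[ℝ] ℝ

/-- The coefficient of `η` in the chart `e`: `η = density η e · dx¹ ∧ … ∧ dxᵐ` in the chart `e`. -/
def density (η : BaseForm m M) (e : OpenPartialHomeomorph M (BaseModel m)) (x : BaseModel m) : ℝ :=
  η (e.symm x) fun i => (chartDeriv e (e.symm x)).inverse (EuclideanSpace.single i 1)

/-- A volume form on `M`: a smooth nowhere vanishing `m`-form. -/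
structure IsVolumeForm (η : BaseForm m M) : Prop where
  ne_zero : ∀ x, η x ≠ 0
  smooth : ∀ e ∈ IsManifold.maximalAtlas 𝓘(ℝ, BaseModel m) ∞ M,
    ContDiffOn ℝ ∞ (density η e) e.target

namespace Jet

/-- The vertical part `w - hor (Tπ w)` of a tangent vector to `E`, with respect to the jet `j`; in
coordinates `(d y^A - v^A_α d x^α) ∂/∂y^A`. -/
def vert (j : Jet m n π) : TangentSpace 𝓘(ℝ, TotModel m n) j.pt →L[ℝ]
    TangentSpace 𝓘(ℝ, TotModel m n) j.pt :=
  ContinuousLinearMap.id ℝ _ - j.hor.comp (dproj m n π j.pt)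

theorem dproj_vert (j : Jet m n π) (w : TangentSpace 𝓘(ℝ, TotModel m n) j.pt) :
    dproj m n π j.pt (j.vert w) = 0 := by
  have := DFunLike.congr_fun j.dproj_comp_hor (dproj m n π j.pt w)
  simp only [ContinuousLinearMap.comp_apply] at this
  simp [vert, this]

/-- The affine action of `Hom (T_{π y} M, V_y π)` on the fibre of `J¹π`. -/
def shift (j : Jet m n π) (A : VertHom m n π j.pt) : Jet m n π where
  pt := j.pt
  hor := j.hor + A
  dproj_comp_hor := by
    rw [ContinuousLinearMap.comp_add, j.dproj_comp_hor, (VertHom.mem_iff _).1 A.2, add_zero]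

/-- The fibre derivative of `L : J¹π → ℝ` at `j`; in coordinates `∂L/∂v^A_α`. -/
def fibreDeriv (L : Jet m n π → ℝ) (j : Jet m n π) : Module.Dual ℝ (VertHom m n π j.pt) :=
  (fderiv ℝ (fun A : VertHom m n π j.pt => L (j.shift A)) 0).toLinearMap

/-- The vertical endomorphism at `j`, as a form on `T_y E` with values in the vertical space
`Hom (T_{π y} M, V_y π)` of `J¹π → E` (its value on vectors of `T_j J¹π` is `Jet.vertEndo`). With
`η = dx¹ ∧ … ∧ dxᵐ` it is
`(d y^A - v^A_α d x^α) ∧ i(∂/∂x^β) η ⊗ ∂/∂v^A_β`: its value on `w` sends `u` to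
`∑ i, η (Tπ w₁, …, u, …, Tπ w_m) • vert (w i)`, with `u` in the `i`-th slot. -/
def vertForm (η : BaseForm m M) (j : Jet m n π) :
    TangentSpace 𝓘(ℝ, TotModel m n) j.pt [⋀^Fin m]→ₗ[ℝ] VertHom m n π j.pt where
  toFun w := ∑ i, ⟨((η (π j.pt)).toContinuousLinearMap (fun k => dproj m n π j.pt (w k)) i).smulRight
      (j.vert (w i)), by
        rw [VertHom.mem_iff]
        ext u
        simp [j.dproj_vert]⟩
  map_update_add' {inst} w i x y := by
    cases Subsingleton.elim inst (instDecidableEqFin m)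
    ext u
    have h := (insertSum (η (π j.pt)).toAlternatingMap (dproj m n π j.pt).toLinearMap
      j.vert.toLinearMap u).map_update_add w i x y
    simp only [insertSum_apply] at h
    simpa using! h
  map_update_smul' {inst} w i c x := by
    cases Subsingleton.elim inst (instDecidableEqFin m)
    ext u
    have h := (insertSum (η (π j.pt)).toAlternatingMap (dproj m n π j.pt).toLinearMap
      j.vert.toLinearMap u).map_update_smul w i c x
    simp only [insertSum_apply] at h
    simpa using! h
  map_eq_zero_of_eq' w a b hab hne := by
    ext u
    simpa using! (insertSum (η (π j.pt)).toAlternatingMap (dproj m n π j.pt).toLinearMap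
      j.vert.toLinearMap u).map_eq_zero_of_eq w hab hne

end Jet

end Lagrangian

section Submanifolds

variable {V X : Type*} [NormedAddCommGroup V] [NormedSpace ℝ V]
  [TopologicalSpace X] [ChartedSpace V X]

/-- `S` is an embedded (regular) submanifold: near each of its points it is, in a suitable chart, a
linear subspace of the model. -/
def IsEmbeddedSubmanifold (V : Type*) {X : Type*} [NormedAddCommGroup V] [NormedSpace ℝ V]
    [TopologicalSpace X] [ChartedSpace V X] (S : Set X) : Prop :=
  ∀ x ∈ S, ∃ e ∈ IsManifold.maximalAtlas 𝓘(ℝ, V) ∞ X, x ∈ e.source ∧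
    ∃ W : Submodule ℝ V, ∀ y ∈ e.source, y ∈ S ↔ e y ∈ W

/-- The tangent space of `S` at `x`, spanned by the velocities at `x` of smooth curves in `S`. -/
def tangentTo (S : Set X) (x : X) : Submodule ℝ (TangentSpace 𝓘(ℝ, V) x) :=
  Submodule.span ℝ {v | ∃ γ : ℝ → X, ContMDiffAt 𝓘(ℝ, ℝ) 𝓘(ℝ, V) ∞ γ 0 ∧
    (∀ᶠ t in 𝓝 (0 : ℝ), γ t ∈ S) ∧
    (⟨γ 0, mfderiv 𝓘(ℝ, ℝ) 𝓘(ℝ, V) γ 0 (1 : ℝ)⟩ : TangentBundle 𝓘(ℝ, V) X) = ⟨x, v⟩}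

end Submanifolds

section MultiVectors

variable {m : ℕ} {V X : Type*} [NormedAddCommGroup V] [NormedSpace ℝ V]
  [TopologicalSpace X] [ChartedSpace V X]

/-- Fields of `m`-vectors on `X`, without regularity. Fields on a subset `S` are described by fields on
`X` of which only the values at the points of `S` are used. -/
abbrev MultiVectorField (m : ℕ) (V X : Type*) [NormedAddCommGroup V] [NormedSpace ℝ V]
    [TopologicalSpace X] [ChartedSpace V X] :=
  ∀ x : X, ⋀[ℝ]^m (TangentSpace 𝓘(ℝ, V) x)

/-- The contraction of an `m`-vector with an alternating `m`-form; on `Y₁ ∧ … ∧ Y_m` it is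
`α (Y₁, …, Y_m)`. -/
def contract {W F : Type*} [AddCommGroup W] [Module ℝ W] [AddCommGroup F] [Module ℝ F]
    (α : W [⋀^Fin m]→ₗ[ℝ] F) (𝒳 : ⋀[ℝ]^m W) : F :=
  exteriorPower.alternatingMapLinearEquiv α 𝒳

/-- On `U ∩ S` the field `𝒳` is `Y₁ ∧ … ∧ Y_m` for vector fields `Y_i` that are smooth on `U` and
tangent to `S` along `S`. -/
structure IsDecompositionOn [IsManifold 𝓘(ℝ, V) ∞ X] (S U : Set X)
    (𝒳 : MultiVectorField m V X)
    (Y : Fin m → ∀ x : X, TangentSpace 𝓘(ℝ, V) x) : Prop where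
  isOpen : IsOpen U
  smooth : ∀ i, ContMDiffOn 𝓘(ℝ, V) (𝓘(ℝ, V).prod 𝓘(ℝ, V)) ∞
    (fun x => (⟨x, Y i x⟩ : TangentBundle 𝓘(ℝ, V) X)) U
  tangent : ∀ x ∈ S ∩ U, ∀ i, Y i x ∈ tangentTo S x
  eq_wedge : ∀ x ∈ S ∩ U, 𝒳 x = exteriorPower.ιMulti ℝ m fun i => Y i x

/-- `𝒳` is a (smooth) locally decomposable `m`-vector field on the submanifold `S`. -/
def IsLocallyDecomposableOn [IsManifold 𝓘(ℝ, V) ∞ X] (S : Set X)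
    (𝒳 : MultiVectorField m V X) : Prop :=
  ∀ x ∈ S, ∃ U, x ∈ U ∧ ∃ Y, IsDecompositionOn S U 𝒳 Y

/-- The points of `S` at which the distribution spanned by `𝒳 = Y₁ ∧ … ∧ Y_m` is involutive. -/
def involutivitySet [IsManifold 𝓘(ℝ, V) ∞ X] (S : Set X)
    (𝒳 : MultiVectorField m V X) : Set X :=
  {x ∈ S | ∃ U, x ∈ U ∧ ∃ Y, IsDecompositionOn S U 𝒳 Y ∧ ∀ μ ν,
    VectorField.mlieBracket 𝓘(ℝ, V) (Y μ) (Y ν) x ∈ Submodule.span ℝ (range fun ρ => Y ρ x)}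

/-- The integrability algorithm for `𝒳` on `S`; the index starts at the involutivity set. -/
def integrabilitySet [IsManifold 𝓘(ℝ, V) ∞ X] (S : Set X)
    (𝒳 : MultiVectorField m V X) : ℕ → Set X
  | 0 => involutivitySet S 𝒳
  | i + 1 => {x ∈ integrabilitySet S 𝒳 i |
      𝒳 x ∈ LinearMap.range (exteriorPower.map m (tangentTo (integrabilitySet S 𝒳 i) x).subtype)}

/-- `I` is the final submanifold of the integrability algorithm, all of whose steps are submanifolds. -/
structure IsFinalIntegrabilitySubmanifold [IsManifold 𝓘(ℝ, V) ∞ X] (S : Set X)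
    (𝒳 : MultiVectorField m V X) (I : Set X) : Prop where
  submanifold : ∀ i, IsEmbeddedSubmanifold V (integrabilitySet S 𝒳 i)
  stable : ∃ i, integrabilitySet S 𝒳 (i + 1) = integrabilitySet S 𝒳 i ∧ I = integrabilitySet S 𝒳 i

end MultiVectors

section FieldEquations

variable {m n : ℕ} {M E : Type*}
  [TopologicalSpace M] [ChartedSpace (BaseModel m) M]
  [TopologicalSpace E] [ChartedSpace (TotModel m n) E] [IsManifold 𝓘(ℝ, TotModel m n) ∞ E]
  {π : E → M} [hπ : IsFibredManifold m n π]

namespace Jet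

/-- The differential of `J¹π → E`. -/
abbrev dpt (j : Jet m n π) : TangentSpace 𝓘(ℝ, JetModel m n) j →L[ℝ]
    TangentSpace 𝓘(ℝ, TotModel m n) j.pt :=
  mfderiv 𝓘(ℝ, JetModel m n) 𝓘(ℝ, TotModel m n) (Jet.pt : Jet m n π → E) j

/-- The differential of `J¹π → M`. -/
def dbase (j : Jet m n π) : TangentSpace 𝓘(ℝ, JetModel m n) j →L[ℝ]
    TangentSpace 𝓘(ℝ, BaseModel m) (π j.pt) :=
  (dproj m n π j.pt).comp j.dpt

/-- The pull-back `ω` of the volume form `η` to `J¹π`. -/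
def volume (η : BaseForm m M) (j : Jet m n π) :
    TangentSpace 𝓘(ℝ, JetModel m n) j [⋀^Fin m]→ₗ[ℝ] ℝ :=
  (η (π j.pt)).toAlternatingMap.compLinearMap j.dbase.toLinearMap

/-- The vertical endomorphism of `J¹π`, a semi-basic `m`-form with values in the vertical bundle of
`J¹π → E`. -/
def vertEndo (η : BaseForm m M) (j : Jet m n π) :
    TangentSpace 𝓘(ℝ, JetModel m n) j [⋀^Fin m]→ₗ[ℝ] VertHom m n π j.pt :=
  (j.vertForm η).compLinearMap j.dpt.toLinearMap

end Jet

/-- The Poincaré–Cartan `m`-form `i(V) 𝓛 + 𝓛` of the Lagrangian density `𝓛 = L ω`; in coordinates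
`∂L/∂v^A_α (d y^A - v^A_β d x^β) ∧ i(∂/∂x^α) ω + L ω`. -/
def poincareCartan (η : BaseForm m M) (L : Jet m n π → ℝ) (j : Jet m n π) :
    TangentSpace 𝓘(ℝ, JetModel m n) j [⋀^Fin m]→L[ℝ] ℝ :=
  toContinuousForm ((j.fibreDeriv L).compAlternatingMap (j.vertEndo η) + L j • j.volume η)

/-- The Poincaré–Cartan `(m + 1)`-form, minus the exterior derivative of the `m`-form. -/
def poincareCartanExt (η : BaseForm m M) (L : Jet m n π → ℝ) (j : Jet m n π) :
    TangentSpace 𝓘(ℝ, JetModel m n) j [⋀^Fin (m + 1)]→L[ℝ] ℝ :=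
  -extDerivManifold (poincareCartan η L) j

/-- The restricted Legendre map `J¹π → J¹π*`; in coordinates `p^α_A = ∂L/∂v^A_α`. -/
def legendre (L : Jet m n π → ℝ) (j : Jet m n π) : Momentum m n π := ⟨j.pt, j.fibreDeriv L⟩

/-- The differential of the Legendre map. -/
def dlegendre (L : Jet m n π → ℝ) (j : Jet m n π) : TangentSpace 𝓘(ℝ, JetModel m n) j →L[ℝ]
    TangentSpace 𝓘(ℝ, MomModel m n) (legendre L j) :=
  mfderiv 𝓘(ℝ, JetModel m n) 𝓘(ℝ, MomModel m n) (legendre L) j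

/-- `L` is almost-regular: the image of the Legendre map is a closed submanifold, the Legendre map is a
submersion onto it, and its fibres are connected submanifolds. -/
structure IsAlmostRegular (L : Jet m n π → ℝ) : Prop where
  isClosed_range : IsClosed (range (legendre L))
  submanifold_range : IsEmbeddedSubmanifold (MomModel m n) (range (legendre L))
  submersion : ∀ j, LinearMap.range (dlegendre L j).toLinearMap =
    tangentTo (range (legendre L)) (legendre L j)
  fibre_connected : ∀ j, IsConnected (legendre L ⁻¹' {legendre L j})
  fibre_submanifold : ∀ j, IsEmbeddedSubmanifold (JetModel m n) (legendre L ⁻¹' {legendre L j})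

/-- The constraint algorithm: the set number `i + 1` consists of the points `j` of the set number `i`
at which there is a transverse `h : T M → T_j J¹π`, with values in the tangent space of the set
number `i`, that solves `Ω (h u₁, …, h u_m, w) = 0` for all `u` and `w`. -/
def constraintSet (η : BaseForm m M) (L : Jet m n π → ℝ) : ℕ → Set (Jet m n π)
  | 0 => univ
  | i + 1 => {j ∈ constraintSet η L i |
      ∃ h : TangentSpace 𝓘(ℝ, BaseModel m) (π j.pt) →ₗ[ℝ] TangentSpace 𝓘(ℝ, JetModel m n) j,
        (∀ u, h u ∈ tangentTo (constraintSet η L i) j) ∧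
        (∀ u, j.dbase (h u) = u) ∧
        ∀ (u : Fin m → TangentSpace 𝓘(ℝ, BaseModel m) (π j.pt)) (w : TangentSpace 𝓘(ℝ, JetModel m n) j),
          (poincareCartanExt η L j).toAlternatingMap.curryLeft w (fun i => h (u i)) = 0}

/-- `N` is the final constraint submanifold, and all steps of the algorithm are submanifolds. -/
structure IsFinalConstraintSubmanifold (η : BaseForm m M) (L : Jet m n π → ℝ)
    (N : Set (Jet m n π)) : Prop where
  submanifold : ∀ i, IsEmbeddedSubmanifold (JetModel m n) (constraintSet η L i)
  stable : ∃ k, 0 < k ∧ constraintSet η L (k + 1) = constraintSet η L k ∧ N = constraintSet η L k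

/-- `𝒳` is a locally decomposable `m`-vector field on `N` with `i(𝒳) ω = 1` and `i(𝒳) Ω = 0`. -/
structure IsSolutionOn (η : BaseForm m M) (L : Jet m n π → ℝ) (N : Set (Jet m n π))
    (𝒳 : MultiVectorField m (JetModel m n) (Jet m n π)) : Prop where
  decomposable : IsLocallyDecomposableOn N 𝒳
  transverse : ∀ j ∈ N, contract (j.volume η) (𝒳 j) = 1
  field_eq : ∀ j ∈ N, ∀ w,
    contract ((poincareCartanExt η L j).toAlternatingMap.curryLeft w) (𝒳 j) = 0

/-- The map `Λᵐ T_j FL` on `m`-vectors. -/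
def pushforward (L : Jet m n π → ℝ) (j : Jet m n π) :
    ⋀[ℝ]^m (TangentSpace 𝓘(ℝ, JetModel m n) j) →ₗ[ℝ]
      ⋀[ℝ]^m (TangentSpace 𝓘(ℝ, MomModel m n) (legendre L j)) :=
  exteriorPower.map m (dlegendre L j).toLinearMap

/-- The `m`-vector field `𝒳` on `N` projects onto the `m`-vector field `𝒴` on `P = FL (N)`. -/
def IsProjectableOnto (L : Jet m n π → ℝ) (N : Set (Jet m n π))
    (𝒳 : MultiVectorField m (JetModel m n) (Jet m n π))
    (𝒴 : MultiVectorField m (MomModel m n) (Momentum m n π)) : Prop :=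
  ∀ j ∈ N, pushforward L j (𝒳 j) = 𝒴 (legendre L j)

/-- The points of `N` at which `i(𝒳) V = 0`. -/
def semiHolonomicSet (η : BaseForm m M) (N : Set (Jet m n π))
    (𝒳 : MultiVectorField m (JetModel m n) (Jet m n π)) : Set (Jet m n π) :=
  {j ∈ N | contract (j.vertEndo η) (𝒳 j) = 0}

/-- `σ` is a smooth section of the Legendre map over `P = FL (N)` with image `S`. -/
structure IsSectionOnto (L : Jet m n π → ℝ) (N S : Set (Jet m n π))
    (σ : Momentum m n π → Jet m n π) : Prop where
  smooth : ContMDiffOn 𝓘(ℝ, MomModel m n) 𝓘(ℝ, JetModel m n) ∞ σ (legendre L '' N)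
  legendre_apply : ∀ p ∈ legendre L '' N, legendre L (σ p) = p
  image_eq : σ '' (legendre L '' N) = S

/-- The `m`-vector field `𝒳` on `S = σ (P)` is the image `Λᵐ Tσ ∘ 𝒴` of the `m`-vector field `𝒴` on
`P = FL (N)`. -/
def IsImageUnder (L : Jet m n π → ℝ) (N : Set (Jet m n π)) (σ : Momentum m n π → Jet m n π)
    (𝒴 : MultiVectorField m (MomModel m n) (Momentum m n π))
    (𝒳 : MultiVectorField m (JetModel m n) (Jet m n π)) : Prop :=
  ∀ p ∈ legendre L '' N, 𝒳 (σ p) = exteriorPower.map m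
    (mfderivWithin 𝓘(ℝ, MomModel m n) 𝓘(ℝ, JetModel m n) σ (legendre L '' N) p).toLinearMap (𝒴 p)

/-- `s : U → I` is a smooth integral section of `𝒳`: a section of `J¹π → M` such that the tangent
`m`-vectors of its image are the multiples of `𝒳`. -/
structure IsIntegralSection (I : Set (Jet m n π))
    (𝒳 : MultiVectorField m (JetModel m n) (Jet m n π))
    (U : Set M) (s : M → Jet m n π) : Prop where
  smooth : ContMDiffOn 𝓘(ℝ, BaseModel m) 𝓘(ℝ, JetModel m n) ∞ s U
  isSection : ∀ x ∈ U, π (s x).pt = x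
  mem : ∀ x ∈ U, s x ∈ I
  tangent : ∀ x ∈ U, LinearMap.range (exteriorPower.map m
    (mfderiv 𝓘(ℝ, BaseModel m) 𝓘(ℝ, JetModel m n) s x).toLinearMap) = Submodule.span ℝ {𝒳 (s x)}

/-- `j` is the `1`-jet of `φ` at the base point `x` of `j`: `φ x` is the point of `E` under `j`, and
`T_x φ` is the linear map `j`. -/
def Jet.IsJetOf (j : Jet m n π) (φ : M → E) : Prop :=
  ∀ u : TangentSpace 𝓘(ℝ, BaseModel m) (π j.pt),
    (⟨j.pt, j.hor u⟩ : TangentBundle 𝓘(ℝ, TotModel m n) E) =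
      ⟨φ (π j.pt), mfderiv 𝓘(ℝ, BaseModel m) 𝓘(ℝ, TotModel m n) φ (π j.pt) u⟩

open Classical in
/-- The coordinate expression `L̂ (x, y, v)` of the Lagrangian density, `𝓛 = L̂ dx¹ ∧ … ∧ dxᵐ`, in the
adapted chart `a`. -/
def localLagrangian (η : BaseForm m M) (L : Jet m n π → ℝ) (a : AdaptedChart m n π)
    (z : TotModel m n × JetFib m n) : ℝ :=
  if h : z.1 ∈ a.tot.target then
    L ((jetCoords hπ).glue a (a.tot.symm z.1) (a.tot.map_target h) z.2) * density η a.base z.1.1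
  else 0

/-- The functions `y^A = φ^A (x)`. -/
def localSection (a : AdaptedChart m n π) (φ : M → E) (x : BaseModel m) : FibModel n :=
  (a.tot (φ (a.base.symm x))).2

/-- The coordinates `(x, φ (x), ∂φ/∂x (x))` of the `1`-jet of `φ`. -/
def localProlongation (a : AdaptedChart m n π) (φ : M → E) (x : BaseModel m) :
    TotModel m n × JetFib m n :=
  ((x, localSection a φ x), fderiv ℝ (localSection a φ) x)

/-- The section `φ` satisfies on `U` the Euler–Lagrange equations, in every adapted chart:
`∂L̂/∂y^A (j¹φ) = ∑ α, d/dx^α (∂L̂/∂v^A_α (j¹φ))` for all `A`. -/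
def SolvesEulerLagrange (η : BaseForm m M) (L : Jet m n π → ℝ) (U : Set M) (φ : M → E) : Prop :=
  ∀ (a : AdaptedChart m n π), ∀ x ∈ a.base.target, a.base.symm x ∈ U →
    φ (a.base.symm x) ∈ a.tot.source → ∀ A : Fin n,
      fderiv ℝ (localLagrangian η L a) (localProlongation a φ x)
          ((0, EuclideanSpace.single A 1), 0) =
        ∑ α : Fin m, fderiv ℝ (fun x' =>
          fderiv ℝ (localLagrangian η L a) (localProlongation a φ x')
            (0, (EuclideanSpace.proj α).smulRight (EuclideanSpace.single A 1)))
          x (EuclideanSpace.single α 1)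

end FieldEquations

end FieldTheory

end

open FieldTheory

/-! The field `XS` differs from the solution field `XN` only by directions that neither `Ω` nor the
vertical endomorphism can see. At a point `j` of `S` write `XN = Y₁ ∧ … ∧ Y_m` with each `Y_i`
tangent to `N`. Points of `S` are fixed by `σ ∘ FL`, so `XS = Y'₁ ∧ … ∧ Y'_m` with `Y'_i = Tσ (TFL
Y_i)`, and `FL ∘ σ = id` on `FL (N)` gives `TFL Y'_i = TFL Y_i` (`exists_decomposition`). A vector
in the kernel of `TFL` is vertical over `E`, because `FL` covers the identity of `E`, and it is null
for the fibre Hessian of `L` (`chartDeriv_of_dlegendre_eq_zero`). The vertical endomorphism is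
semi-basic over `E` and therefore ignores such vectors; `Ω` ignores them too
(`poincareCartanExt_eq_zero`). Hence both `i(XS) V = 0` and `i(XS) Ω = 0` hold on `S`.

An integral section `s` with values in `I ⊆ S` has tangent `m`-vectors proportional to `XS`, so both
equations hold for the vectors `Ts u`. The first one forces the projection of `Ts` to `TE` to be the
jet `s x` itself (`dpt_lift_eq_hor`): `s` is the prolongation of its projection `φ` to `E`. For such
a section, contracting `Ω` with `∂/∂y^A` and the `m` coordinate vectors tangent to `s` leaves, up to
sign, the difference of the two sides of the Euler–Lagrange equation (`localFormExt_holonomic`).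

All computations take place in adapted charts. There the density of `η` is absorbed into the local
Lagrangian (`poincareCartan_apply`), so `Ω` is minus the exterior derivative of an explicit form in
every adapted chart (`poincareCartanExt_apply`); this uses that the exterior derivative does not
depend on the chart (`extDerivManifold_eq`). -/

namespace FieldTheory

noncomputable section

set_option linter.unusedSectionVars false

/-! ### Smooth maps and their differentials in charts. -/

section ChartExpressions

variable {V V' X X' : Type*} [NormedAddCommGroup V] [NormedSpace ℝ V]
  [NormedAddCommGroup V'] [NormedSpace ℝ V']
  [TopologicalSpace X] [ChartedSpace V X] [TopologicalSpace X'] [ChartedSpace V' X']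
  {e : OpenPartialHomeomorph X V} {e' : OpenPartialHomeomorph X' V'}

/-- Near `x` the map is `e'.symm ∘ F ∘ e`. Continuity of `f` is not assumed, which is why `f y ∈
e'.source` is required on a whole neighbourhood. -/
theorem contMDiffAt_of_chart_expr (he : e ∈ IsManifold.maximalAtlas 𝓘(ℝ, V) ∞ X)
    (he' : e' ∈ IsManifold.maximalAtlas 𝓘(ℝ, V') ∞ X') {f : X → X'} {F : V → V'} {x : X}
    (hx : x ∈ e.source) (hf : ∀ᶠ y in 𝓝 x, f y ∈ e'.source ∧ e' (f y) = F (e y))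
    (hF : ContDiffAt ℝ ∞ F (e x)) : ContMDiffAt 𝓘(ℝ, V) 𝓘(ℝ, V') ∞ f x := by
  have h1 : ContMDiffAt 𝓘(ℝ, V) 𝓘(ℝ, V) ∞ e x :=
    (contMDiffOn_of_mem_maximalAtlas he).contMDiffAt (e.open_source.mem_nhds hx)
  have h2 : ContMDiffAt 𝓘(ℝ, V) 𝓘(ℝ, V') ∞ (F ∘ e) x := hF.contMDiffAt.comp x h1
  have hx' := hf.self_of_nhds
  have h3 : ContMDiffAt 𝓘(ℝ, V') 𝓘(ℝ, V') ∞ e'.symm (F (e x)) := by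
    refine (contMDiffOn_symm_of_mem_maximalAtlas he').contMDiffAt (e'.open_target.mem_nhds ?_)
    rw [← hx'.2]
    exact e'.map_source hx'.1
  refine (h3.comp x h2).congr_of_eventuallyEq ?_
  filter_upwards [hf] with y hy
  simp [← hy.2, e'.left_inv hy.1]

theorem chartDeriv_comp_mfderiv (he : e ∈ IsManifold.maximalAtlas 𝓘(ℝ, V) ∞ X)
    (he' : e' ∈ IsManifold.maximalAtlas 𝓘(ℝ, V') ∞ X') {f : X → X'} {F : V → V'} {x : X}
    (hx : x ∈ e.source) (hx' : f x ∈ e'.source) (hf : ∀ᶠ y in 𝓝 x, e' (f y) = F (e y))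
    (hd : MDifferentiableAt 𝓘(ℝ, V) 𝓘(ℝ, V') f x) (hF : DifferentiableAt ℝ F (e x)) :
    (chartDeriv e' (f x)).comp (mfderiv 𝓘(ℝ, V) 𝓘(ℝ, V') f x) =
      (fderiv ℝ F (e x)).comp (chartDeriv e x) := by
  have h1 := ((chart_mdifferentiable he).mdifferentiableAt hx).hasMFDerivAt
  have h2 := (((chart_mdifferentiable he').mdifferentiableAt hx').hasMFDerivAt).comp x
    hd.hasMFDerivAt
  have h3 := (hF.hasFDerivAt.hasMFDerivAt).comp x h1
  have h4 : e' ∘ f =ᶠ[𝓝 x] F ∘ e := hf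
  exact hasMFDerivAt_unique h2 (h3.congr_of_eventuallyEq h4)

/-- The differential of a map in charts. -/
theorem chartDeriv_mfderiv_apply (he' : e' ∈ IsManifold.maximalAtlas 𝓘(ℝ, V') ∞ X') {f : X → X'}
    {x : X} (hx' : f x ∈ e'.source) (he : e ∈ IsManifold.maximalAtlas 𝓘(ℝ, V) ∞ X)
    (hx : x ∈ e.source) (hd : MDifferentiableAt 𝓘(ℝ, V) 𝓘(ℝ, V') f x) :
    DifferentiableAt ℝ (e' ∘ f ∘ e.symm) (e x) ∧
    (chartDeriv e' (f x)).comp (mfderiv 𝓘(ℝ, V) 𝓘(ℝ, V') f x) =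
      (fderiv ℝ (e' ∘ f ∘ e.symm) (e x)).comp (chartDeriv e x) := by
  have h1 : MDifferentiableAt 𝓘(ℝ, V) 𝓘(ℝ, V) e.symm (e x) :=
    (chart_mdifferentiable he).mdifferentiableAt_symm (e.map_source hx)
  have h2 : MDifferentiableAt 𝓘(ℝ, V) 𝓘(ℝ, V') (f ∘ e.symm) (e x) := by
    refine MDifferentiableAt.comp (e x) ?_ h1
    rwa [e.left_inv hx]
  have h3 : MDifferentiableAt 𝓘(ℝ, V) 𝓘(ℝ, V') (e' ∘ f ∘ e.symm) (e x) := by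
    refine MDifferentiableAt.comp (e x) ?_ h2
    refine (chart_mdifferentiable he').mdifferentiableAt ?_
    simpa [e.left_inv hx] using hx'
  have h4 : DifferentiableAt ℝ (e' ∘ f ∘ e.symm) (e x) := mdifferentiableAt_iff_differentiableAt.1 h3
  refine ⟨h4, chartDeriv_comp_mfderiv he he' hx hx' ?_ hd h4⟩
  filter_upwards [e.open_source.mem_nhds hx] with y hy
  simp [e.left_inv hy]

theorem chartDeriv_mfderiv_symm (he : e ∈ IsManifold.maximalAtlas 𝓘(ℝ, V) ∞ X) {z : V}
    (hz : z ∈ e.target) (w : V) :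
    chartDeriv e (e.symm z) (mfderiv 𝓘(ℝ, V) 𝓘(ℝ, V) e.symm z w) = w :=
  DFunLike.congr_fun ((chart_mdifferentiable he).comp_symm_deriv hz) w

theorem mfderiv_symm_chartDeriv (he : e ∈ IsManifold.maximalAtlas 𝓘(ℝ, V) ∞ X) {x : X}
    (hx : x ∈ e.source) (w : TangentSpace 𝓘(ℝ, V) x) :
    mfderiv 𝓘(ℝ, V) 𝓘(ℝ, V) e.symm (e x) (chartDeriv e x w) = w :=
  DFunLike.congr_fun ((chart_mdifferentiable he).symm_comp_deriv hx) w

end ChartExpressions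

/-! ### Chart independence of the exterior derivative. -/

section ExteriorDerivative

variable {k : ℕ} {V X : Type*} [NormedAddCommGroup V] [NormedSpace ℝ V]
  [TopologicalSpace X] [ChartedSpace V X]

/-- A map into the alternating forms on a finite-dimensional space is differentiable if its
evaluations are. -/
theorem differentiableAt_alternatingForm [FiniteDimensional ℝ V] {W : Type*} [NormedAddCommGroup W]
    [NormedSpace ℝ W] {f : W → V [⋀^Fin k]→L[ℝ] ℝ} {z : W}
    (h : ∀ v, DifferentiableAt ℝ (fun y => f y v) z) : DifferentiableAt ℝ f z := by
  let b := Module.finBasis ℝ V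
  -- A form is determined by its values on tuples of basis vectors. A linear left inverse of this
  -- evaluation writes `f` as a linear map applied to finitely many differentiable functions.
  let ev : (V [⋀^Fin k]→L[ℝ] ℝ) →ₗ[ℝ] ((Fin k → Fin (Module.finrank ℝ V)) → ℝ) :=
    { toFun := fun g r => g fun i => b (r i)
      map_add' := fun _ _ => rfl
      map_smul' := fun _ _ => rfl }
  have hinj : LinearMap.ker ev = ⊥ := by
    refine LinearMap.ker_eq_bot.2 fun g g' hg => ?_
    have : g.toAlternatingMap = g'.toAlternatingMap := by
      refine AlternatingMap.coe_multilinearMap_injective ?_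
      exact Module.Basis.ext_multilinear (fun _ => b) fun r => congrFun hg r
    ext v
    exact DFunLike.congr_fun this v
  obtain ⟨g, hg⟩ := ev.exists_leftInverse_of_injective hinj
  have h1 : DifferentiableAt ℝ (fun y => ev (f y)) z :=
    differentiableAt_pi.2 fun r => h _
  have h2 : f = fun y => LinearMap.toContinuousLinearMap g (ev (f y)) := by
    ext1 y
    exact (DFunLike.congr_fun hg (f y)).symm
  rw [h2]
  exact (LinearMap.toContinuousLinearMap g).differentiableAt.comp z h1

/-- The coordinate expression of a form in the chart `e`. -/
def chartForm (Φ : ∀ x : X, TangentSpace 𝓘(ℝ, V) x [⋀^Fin k]→L[ℝ] ℝ)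
    (e : OpenPartialHomeomorph X V) (z : V) : V [⋀^Fin k]→L[ℝ] ℝ :=
  (Φ (e.symm z)).compContinuousLinearMap (mfderiv 𝓘(ℝ, V) 𝓘(ℝ, V) e.symm z)

/-- Chain rule for the transition map: coordinate expressions of one form in two charts are
pull-backs of each other. -/
theorem chartForm_transition {e e' : OpenPartialHomeomorph X V}
    (Φ : ∀ x : X, TangentSpace 𝓘(ℝ, V) x [⋀^Fin k]→L[ℝ] ℝ)
    (he : e ∈ IsManifold.maximalAtlas 𝓘(ℝ, V) ∞ X)
    (he' : e' ∈ IsManifold.maximalAtlas 𝓘(ℝ, V) ∞ X) {z : V} (hz : z ∈ (e.symm ≫ₕ e').source) :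
    chartForm Φ e z = (chartForm Φ e' ((e' ∘ e.symm) z)).compContinuousLinearMap
      (fderiv ℝ (e' ∘ e.symm) z) := by
  have hz1 : z ∈ e.target := by simpa using hz.1
  have hz2 : e.symm z ∈ e'.source := by simpa using hz.2
  ext w
  -- The point `e'.symm (e' (e.symm z))` equals `e.symm z` only propositionally, so the comparison
  -- of forms on the two tangent spaces is made for a variable point `x`.
  have key : ∀ x : X, x = e.symm z → ∀ T : V →L[ℝ] TangentSpace 𝓘(ℝ, V) x,
      (∀ w, T w = mfderiv 𝓘(ℝ, V) 𝓘(ℝ, V) e.symm z w) →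
      (Φ (e.symm z)).compContinuousLinearMap (mfderiv 𝓘(ℝ, V) 𝓘(ℝ, V) e.symm z) w =
        (Φ x).compContinuousLinearMap T w := by
    rintro x rfl T hT
    exact congrArg (Φ (e.symm z)) (funext fun i => (hT (w i)).symm)
  refine key _ (e'.left_inv hz2)
    ((mfderiv 𝓘(ℝ, V) 𝓘(ℝ, V) e'.symm (e' (e.symm z))).comp (fderiv ℝ (e' ∘ e.symm) z)) ?_
  intro w
  have h := chartDeriv_transition he he' (e.map_target hz1) hz2
  have h' := DFunLike.congr_fun h (mfderiv 𝓘(ℝ, V) 𝓘(ℝ, V) e.symm z w)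
  rw [e.right_inv hz1] at h'
  simp only [ContinuousLinearMap.comp_apply] at h' ⊢
  rw [chartDeriv_mfderiv_symm he hz1] at h'
  exact (congrArg (mfderiv 𝓘(ℝ, V) 𝓘(ℝ, V) e'.symm (e' (e.symm z))) h'.symm).trans
    (mfderiv_symm_chartDeriv he' hz2 _)

/-- The exterior derivative of a form can be computed in any chart. -/
theorem extDerivManifold_eq [IsManifold 𝓘(ℝ, V) ∞ X] {e : OpenPartialHomeomorph X V}
    (Φ : ∀ x : X, TangentSpace 𝓘(ℝ, V) x [⋀^Fin k]→L[ℝ] ℝ)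
    (he : e ∈ IsManifold.maximalAtlas 𝓘(ℝ, V) ∞ X) {x : X} (hx : x ∈ e.source)
    (hd : DifferentiableAt ℝ (chartForm Φ (chartAt V x)) (chartAt V x x)) :
    extDerivManifold Φ x =
      (extDeriv (chartForm Φ e) (e x)).compContinuousLinearMap (chartDeriv e x) := by
  have hc : chartAt V x ∈ IsManifold.maximalAtlas 𝓘(ℝ, V) ∞ X :=
    IsManifold.chart_mem_maximalAtlas x
  have hxc : x ∈ (chartAt V x).source := mem_chart_source V x
  have hmem : e x ∈ (e.symm ≫ₕ chartAt V x).source := by simp [hx]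
  have h1 : chartForm Φ e =ᶠ[𝓝 (e x)] fun z =>
      (chartForm Φ (chartAt V x) ((chartAt V x ∘ e.symm) z)).compContinuousLinearMap
        (fderiv ℝ (chartAt V x ∘ e.symm) z) := by
    filter_upwards [(e.symm ≫ₕ chartAt V x).open_source.mem_nhds hmem] with z hz
    exact chartForm_transition Φ he hc hz
  have hpt : (chartAt V x ∘ e.symm) (e x) = chartAt V x x := by simp [e.left_inv hx]
  have h2 : ContDiffAt ℝ ∞ (chartAt V x ∘ e.symm) (e x) :=
    (contDiffOn_transition he hc).contDiffAt ((e.symm ≫ₕ chartAt V x).open_source.mem_nhds hmem)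
  -- The exterior derivative commutes with the pull-back by the transition map; the last argument is
  -- the `C²` requirement.
  rw [h1.extDeriv_eq, extDeriv_pullback (by rwa [hpt]) h2 (by simpa using! WithTop.coe_le_coe.2 (le_top : (2 : ℕ∞) ≤ ⊤)), hpt]
  have h3 := chartDeriv_transition he hc hx hxc
  ext w
  simp only [ContinuousAlternatingMap.compContinuousLinearMap_apply]
  change extDeriv (chartForm Φ (chartAt V x)) (chartAt V x x) (chartDeriv (chartAt V x) x ∘ w) = _
  congr 1
  ext i
  simp [h3]

end ExteriorDerivative

/-! ### Alternating maps modulo a subspace. -/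

section Multilinear

open Function in
/-- An alternating map that vanishes if one argument is in `K` only depends on its arguments
modulo `K`. -/
theorem alternatingMap_eq_of_sub_mem {ι R V F : Type*} [Fintype ι] [DecidableEq ι] [Ring R]
    [AddCommGroup V] [Module R V] [AddCommGroup F] [Module R F] (f : V [⋀^ι]→ₗ[R] F)
    (K : Submodule R V) (h : ∀ v : ι → V, ∀ i, v i ∈ K → f v = 0) {v w : ι → V}
    (hvw : ∀ i, v i - w i ∈ K) : f v = f w := by
  have h1 : v = w + (v - w) := by simp
  have h2 := f.toMultilinearMap.map_add_univ w (v - w)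
  rw [← h1] at h2
  refine h2.trans ?_
  -- The expansion runs over the sets `s` of slots filled from `w`; every term but `s = univ` has a
  -- slot filled from `v - w`, hence in `K`.
  rw [Finset.sum_eq_single Finset.univ]
  · simp
  · intro s _ hs
    obtain ⟨i, hi⟩ : ∃ i, i ∉ s := by
      by_contra! hc
      exact hs (Finset.eq_univ_iff_forall.2 hc)
    refine h _ i ?_
    simpa [Finset.piecewise, hi] using hvw i
  · simp

end Multilinear

/-! ### The standard volume form and densities. -/

section VolumeForm

/-- The standard volume form of `ℝᵐ`. -/
def stdVol (m : ℕ) : BaseModel m [⋀^Fin m]→L[ℝ] ℝ :=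
  { (EuclideanSpace.basisFun (Fin m) ℝ).toBasis.det with
    cont := continuous_alternatingMap _ }

theorem stdVol_apply {m : ℕ} (u : Fin m → BaseModel m) :
    stdVol m u = (EuclideanSpace.basisFun (Fin m) ℝ).toBasis.det u := rfl

theorem stdVol_single (m : ℕ) :
    stdVol m (fun i => EuclideanSpace.single i (1 : ℝ)) = 1 := by
  rw [stdVol_apply]
  convert (EuclideanSpace.basisFun (Fin m) ℝ).toBasis.det_self using 2
  ext1 i
  simp

open Function in
/-- Cramer's rule. -/
theorem sum_stdVol_update_smul {m : ℕ} (X : Fin m → BaseModel m) (u : BaseModel m) :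
    ∑ i, stdVol m (update X i u) • X i = stdVol m X • u := by
  have h : ∀ Y : Fin m → BaseModel m, stdVol m Y = (Matrix.of fun k i => Y i k).det := by
    intro Y
    rw [stdVol_apply, Module.Basis.det_apply]
    congr 1
  have h2 := Matrix.mulVec_cramer (Matrix.of fun k i => X i k) (fun k => u k)
  ext k
  have h3 := congrFun h2 k
  simp only [Pi.smul_apply, ← h, Matrix.mulVec, dotProduct, Matrix.cramer_apply] at h3
  simp only [PiLp.smul_apply, smul_eq_mul] at h3 ⊢
  rw [← h3]
  rw [show ((∑ i, stdVol m (update X i u) • X i) : BaseModel m) k =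
    ∑ i, stdVol m (update X i u) * X i k by simp]
  refine Finset.sum_congr rfl fun i _ => ?_
  rw [h, mul_comm]
  refine congrArg (X i k * ·) (congrArg Matrix.det ?_)
  ext r c
  by_cases hc : c = i
  · subst hc; simp
  · simp [hc]

-- Cramer's rule for the standard frame, read off in coordinate `i`: filling all slots but the
-- `i`-th with the frame turns the volume form into `dx^i`.
open Function in
theorem stdVol_update_single {m : ℕ} (i : Fin m) (u : BaseModel m) :
    stdVol m (update (fun i => EuclideanSpace.single i (1 : ℝ)) i u) = u i := by
  have h := congrArg (fun v : BaseModel m => v i)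
    (sum_stdVol_update_smul (fun i => EuclideanSpace.single i (1 : ℝ)) u)
  simpa [stdVol_single, Pi.single_apply] using h

variable {m : ℕ} {M : Type*} [TopologicalSpace M] [ChartedSpace (BaseModel m) M]

/-- Forms of top degree are multiples of the determinant, and the factor is the value on the
standard basis, which is the density. -/
theorem form_apply_eq_density_mul (η : BaseForm m M) {e : OpenPartialHomeomorph M (BaseModel m)}
    (he : e ∈ IsManifold.maximalAtlas 𝓘(ℝ, BaseModel m) ∞ M) {x : M} (hx : x ∈ e.source)
    (u : Fin m → TangentSpace 𝓘(ℝ, BaseModel m) x) :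
    η x u = density η e (e x) * stdVol m fun i => chartDeriv e x (u i) := by
  have h1 := chartDeriv_isInvertible he hx
  let f : BaseModel m [⋀^Fin m]→ₗ[ℝ] ℝ :=
    (η x).toAlternatingMap.compLinearMap (chartDeriv e x).inverse.toLinearMap
  have h2 : f = _ := f.eq_smul_basis_det (EuclideanSpace.basisFun (Fin m) ℝ).toBasis
  have h3 := DFunLike.congr_fun h2 fun i => chartDeriv e x (u i)
  have h4 : f (fun i => chartDeriv e x (u i)) = η x u := by
    change η x (fun i => (chartDeriv e x).inverse (chartDeriv e x (u i))) = η x u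
    congr 1
    ext1 i
    rw [h1.inverse_apply_eq]
  rw [h4] at h3
  rw [h3]
  simp only [AlternatingMap.smul_apply, smul_eq_mul, ← stdVol_apply]
  congr 1
  rw [density, e.left_inv hx]
  change η x (fun i => (chartDeriv e x).inverse _) = _
  congr 1
  ext1 i
  simp

end VolumeForm

/-! ### Charts of the jet and momentum bundles over adapted charts. -/

section Charts

variable {m n : ℕ} {M E : Type*}
  [TopologicalSpace M] [ChartedSpace (BaseModel m) M]
  [TopologicalSpace E] [ChartedSpace (TotModel m n) E] [IsManifold 𝓘(ℝ, TotModel m n) ∞ E]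
  {π : E → M} [hπ : IsFibredManifold m n π]

/-- The chart of `J¹π` over an adapted chart. -/
def jetChart (a : AdaptedChart m n π) (q : Jet m n π) :
    OpenPartialHomeomorph (Jet m n π) (JetModel m n) :=
  ((jetCoords hπ).core hπ).openPartialHomeomorph ((jetCoords hπ).chart a q) ⟨(a, q), rfl⟩

/-- The chart of `J¹π*` over an adapted chart. -/
def momentumChart (a : AdaptedChart m n π) (q : Momentum m n π) :
    OpenPartialHomeomorph (Momentum m n π) (MomModel m n) :=
  ((momentumCoords hπ).core hπ).openPartialHomeomorph ((momentumCoords hπ).chart a q)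
    ⟨(a, q), rfl⟩

variable (a : AdaptedChart m n π) (q : Jet m n π) (r : Momentum m n π)

theorem jetChart_mem_maximalAtlas :
    jetChart a q ∈ IsManifold.maximalAtlas 𝓘(ℝ, JetModel m n) ∞ (Jet m n π) := by
  refine IsManifold.subset_maximalAtlas ?_
  refine mem_iUnion₂.2 ⟨(jetCoords hπ).chart a q, ⟨(a, q), rfl⟩, rfl⟩

theorem momentumChart_mem_maximalAtlas :
    momentumChart a r ∈ IsManifold.maximalAtlas 𝓘(ℝ, MomModel m n) ∞ (Momentum m n π) := by
  refine IsManifold.subset_maximalAtlas ?_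
  refine mem_iUnion₂.2 ⟨(momentumCoords hπ).chart a r, ⟨(a, r), rfl⟩, rfl⟩

theorem jetChart_apply (j : Jet m n π) :
    jetChart a q j = (a.tot j.pt, a.ofTangent j.pt j.hor) := rfl

theorem mem_jetChart_target {z : JetModel m n} :
    z ∈ (jetChart a q).target ↔ z.1 ∈ a.tot.target :=
  ⟨fun h => h.1, fun h => ⟨h, mem_univ _⟩⟩

theorem jetChart_symm_apply {z : JetModel m n} (h : z.1 ∈ a.tot.target) :
    (jetChart a q).symm z = (jetCoords hπ).glue a (a.tot.symm z.1) (a.tot.map_target h) z.2 :=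
  dif_pos h

theorem momentumChart_apply {p : Momentum m n π} (h : p.pt ∈ a.tot.source) :
    momentumChart a r p =
      (a.tot p.pt, LinearMap.toContinuousLinearMap (p.mom ∘ₗ a.toVertHom hπ p.pt h)) := by
  exact congrArg (Prod.mk (a.tot p.pt)) (dif_pos h)

theorem mem_momentumChart_source {p : Momentum m n π} :
    p ∈ (momentumChart a r).source ↔ p.pt ∈ a.tot.source := Iff.rfl

/-- The exterior derivative is defined through the preferred chart; as that chart lies over an
adapted one, the coordinate formulas apply to it. -/
theorem chartAt_jet_eq (j : Jet m n π) :
    ∃ a : AdaptedChart m n π, j.pt ∈ a.tot.source ∧ chartAt (JetModel m n) j = jetChart a j :=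
  ⟨_, (exists_adaptedChart hπ j.pt).choose_spec, rfl⟩

end Charts

theorem fderiv_affine_comp {K G : Type*} [NormedAddCommGroup K] [NormedSpace ℝ K]
    [FiniteDimensional ℝ K] [NormedAddCommGroup G] [NormedSpace ℝ G] (φ : K →ₗ[ℝ] G)
    {g : G → ℝ} {c : G} (hd : DifferentiableAt ℝ g c) (A : K) :
    fderiv ℝ (fun B : K => g (c + φ B)) 0 A = fderiv ℝ g c (φ A) := by
  have h1 : HasFDerivAt (fun B : K => c + φ B) (LinearMap.toContinuousLinearMap φ) 0 :=
    (LinearMap.toContinuousLinearMap φ).hasFDerivAt.const_add c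
  have h2 : HasFDerivAt g (fderiv ℝ g c) (c + φ 0) := by simpa using hd.hasFDerivAt
  have h3 := h2.comp (0 : K) h1
  exact DFunLike.congr_fun h3.fderiv A

/-! ### Coordinate expressions of the geometric objects on the jet bundle. -/

section Coordinates

variable {m n : ℕ} {M E : Type*}
  [TopologicalSpace M] [ChartedSpace (BaseModel m) M]
  [TopologicalSpace E] [ChartedSpace (TotModel m n) E] [IsManifold 𝓘(ℝ, TotModel m n) ∞ E]
  {π : E → M} [hπ : IsFibredManifold m n π]
  (a : AdaptedChart m n π) (q : Jet m n π)

theorem AdaptedChart.fst_mem_target {z : TotModel m n} (hz : z ∈ a.tot.target) :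
    z.1 ∈ a.base.target ∧ a.base.symm z.1 = π (a.tot.symm z) := by
  have h := a.fst_eq _ (a.tot.map_target hz)
  rw [a.tot.right_inv hz] at h
  have h2 := a.mapsTo (a.tot.map_target hz)
  rw [h]
  exact ⟨a.base.map_source h2, a.base.left_inv h2⟩

theorem jet_mem_chart_source {j : Jet m n π} (hj : j.pt ∈ a.tot.source) :
    j ∈ (jetChart a q).source := hj

theorem contMDiff_jet_pt :
    ContMDiff 𝓘(ℝ, JetModel m n) 𝓘(ℝ, TotModel m n) ∞ (Jet.pt : Jet m n π → E) := by
  intro j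
  obtain ⟨a, ha⟩ := exists_adaptedChart hπ j.pt
  refine contMDiffAt_of_chart_expr (jetChart_mem_maximalAtlas a j) a.tot_mem (F := Prod.fst)
    (jet_mem_chart_source a j ha) ?_ contDiffAt_fst
  filter_upwards [(jetChart a j).open_source.mem_nhds (jet_mem_chart_source a j ha)] with k hk
  exact ⟨hk, rfl⟩

variable {a} {j : Jet m n π}

theorem chartDeriv_dpt (hj : j.pt ∈ a.tot.source) (w : TangentSpace 𝓘(ℝ, JetModel m n) j) :
    chartDeriv a.tot j.pt (j.dpt w) = (chartDeriv (jetChart a q) j w).1 := by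
  have h := chartDeriv_comp_mfderiv (jetChart_mem_maximalAtlas a q) a.tot_mem
    (f := (Jet.pt : Jet m n π → E)) (F := Prod.fst) (jet_mem_chart_source a q hj) hj
    (Filter.Eventually.of_forall fun k => rfl)
    (contMDiff_jet_pt.mdifferentiable (by simp) j) differentiableAt_fst
  rw [fderiv_fst] at h
  exact DFunLike.congr_fun h w

theorem chartDeriv_dproj (hy : j.pt ∈ a.tot.source)
    (w : TangentSpace 𝓘(ℝ, TotModel m n) j.pt) :
    chartDeriv a.base (π j.pt) (dproj m n π j.pt w) = (chartDeriv a.tot j.pt w).1 :=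
  DFunLike.congr_fun (a.chartDeriv_comp_dproj hπ hy) w

theorem chartDeriv_dbase (hj : j.pt ∈ a.tot.source) (v : TangentSpace 𝓘(ℝ, JetModel m n) j) :
    chartDeriv a.base (π j.pt) (j.dbase v) = (chartDeriv (jetChart a q) j v).1.1 := by
  rw [Jet.dbase, ContinuousLinearMap.comp_apply, chartDeriv_dproj hj, chartDeriv_dpt q hj]

theorem chartDeriv_hor (hj : j.pt ∈ a.tot.source) (u : TangentSpace 𝓘(ℝ, BaseModel m) (π j.pt)) :
    chartDeriv a.tot j.pt (j.hor u) =
      (chartDeriv a.base (π j.pt) u, a.ofTangent j.pt j.hor (chartDeriv a.base (π j.pt) u)) := by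
  have h2 := chartDeriv_isInvertible a.base_mem (a.mapsTo hj)
  refine Prod.ext ?_ ?_
  · rw [← chartDeriv_dproj hj]
    exact congrArg (chartDeriv a.base (π j.pt)) (DFunLike.congr_fun j.dproj_comp_hor u)
  · simp [AdaptedChart.ofTangent, h2]

/-- Expanding `w - hor (Tπ w)` cancels the `x`-part and leaves the contact forms `dy^A - v^A_α
dx^α`. -/
theorem chartDeriv_vert (hj : j.pt ∈ a.tot.source) (w : TangentSpace 𝓘(ℝ, TotModel m n) j.pt) :
    chartDeriv a.tot j.pt (j.vert w) =
      (0, (chartDeriv a.tot j.pt w).2 - (jetChart a q j).2 (chartDeriv a.tot j.pt w).1) := by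
  have h : chartDeriv a.tot j.pt (j.vert w) =
      chartDeriv a.tot j.pt w - chartDeriv a.tot j.pt (j.hor (dproj m n π j.pt w)) := by
    simp [Jet.vert]
  rw [h, chartDeriv_hor hj, chartDeriv_dproj hj]
  refine Prod.ext ?_ rfl
  simp

theorem AdaptedChart.ofTangent_add (a : AdaptedChart m n π) (y : E)
    (A B : TangentSpace 𝓘(ℝ, BaseModel m) (π y) →L[ℝ] TangentSpace 𝓘(ℝ, TotModel m n) y) :
    a.ofTangent y (A + B) = a.ofTangent y A + a.ofTangent y B := by
  ext u
  simp [AdaptedChart.ofTangent]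

/-- The fibre coordinate is affine in the jet, so the action of `VertHom` becomes a translation of
the chart. -/
theorem jetChart_shift (A : VertHom m n π j.pt) :
    jetChart a q (j.shift A) = jetChart a q j + (0, a.ofVertHom j.pt A) := by
  simp only [jetChart_apply]
  refine Prod.ext (by simp [Jet.shift]) ?_
  exact a.ofTangent_add j.pt j.hor A

/-- The space `VertHom` as a space of linear maps between the models. -/
def vertHomModel (y : E) : Submodule ℝ (BaseModel m →L[ℝ] TotModel m n) := VertHom m n π y

/-- Tangent spaces unfold to the model spaces, so this is `rfl`. The model version carries the norm
that `fderiv_affine_comp` asks for. -/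
theorem fderiv_vertHom {y : E} (f : VertHom m n π y → ℝ) (A : VertHom m n π y) :
    fderiv ℝ f 0 A =
      @fderiv ℝ _ (vertHomModel (m := m) (n := n) (π := π) y) _ _ _ ℝ _ _ _ f 0 A := by
  rfl

theorem fderiv_vertHom_affine_comp {y : E} {G : Type*} [NormedAddCommGroup G] [NormedSpace ℝ G]
    (φ : VertHom m n π y →ₗ[ℝ] G) {g : G → ℝ} {c : G} (hd : DifferentiableAt ℝ g c)
    (A : VertHom m n π y) :
    fderiv ℝ (fun B : VertHom m n π y => g (c + φ B)) 0 A = fderiv ℝ g c (φ A) := by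
  rw [fderiv_vertHom]
  let φ' : vertHomModel (m := m) (n := n) (π := π) y →ₗ[ℝ] G :=
    { toFun := fun B => φ B
      map_add' := fun B C => φ.map_add B C
      map_smul' := fun r B => φ.map_smul r B }
  have key := fderiv_affine_comp (K := vertHomModel (m := m) (n := n) (π := π) y) φ' hd
  exact key A

variable {L : Jet m n π → ℝ}

/-- The coordinate expression of `L` is smooth. -/
theorem contDiffOn_comp_jetChart_symm (hL : ContMDiff 𝓘(ℝ, JetModel m n) 𝓘(ℝ, ℝ) ∞ L) :
    ContDiffOn ℝ ∞ (L ∘ (jetChart a q).symm) (jetChart a q).target := by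
  rw [← contMDiffOn_iff_contDiffOn]
  exact hL.comp_contMDiffOn (contMDiffOn_symm_of_mem_maximalAtlas (jetChart_mem_maximalAtlas a q))

/-- The shift by `B` is a translation in the chart, so the intrinsic fibre derivative is the partial
differential in `v` of the coordinate expression of `L`. -/
theorem fibreDeriv_apply (hL : ContMDiff 𝓘(ℝ, JetModel m n) 𝓘(ℝ, ℝ) ∞ L)
    (hj : j.pt ∈ a.tot.source) (A : VertHom m n π j.pt) :
    j.fibreDeriv L A =
      fderiv ℝ (L ∘ (jetChart a q).symm) (jetChart a q j) (0, a.ofVertHom j.pt A) := by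
  have hj' := jet_mem_chart_source a q hj
  have hd : DifferentiableAt ℝ (L ∘ (jetChart a q).symm) (jetChart a q j) :=
    ((contDiffOn_comp_jetChart_symm q hL).contDiffAt
      ((jetChart a q).open_target.mem_nhds ((jetChart a q).map_source hj'))).differentiableAt
      (by simp)
  have h1 : (fun B : VertHom m n π j.pt => L (j.shift B)) = fun B =>
      (L ∘ (jetChart a q).symm) (jetChart a q j +
        (LinearMap.inr ℝ (TotModel m n) (JetFib m n) ∘ₗ a.ofVertHom j.pt) B) := by
    ext B
    have h2 := jetChart_shift (a := a) q B
    simp only [LinearMap.comp_apply, LinearMap.inr_apply, ← h2, Function.comp_apply]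
    rw [(jetChart a q).left_inv (jet_mem_chart_source a q (j := j.shift B) hj)]
  rw [Jet.fibreDeriv, h1]
  exact fderiv_vertHom_affine_comp
    (LinearMap.inr ℝ (TotModel m n) (JetFib m n) ∘ₗ a.ofVertHom j.pt) hd A

/-! ### The local Lagrangian -/

variable {η : BaseForm m M}

theorem localLagrangian_eq {z : JetModel m n} (hz : z.1 ∈ a.tot.target) :
    localLagrangian η L a z = (L ∘ (jetChart a q).symm) z * density η a.base z.1.1 := by
  rw [localLagrangian, dif_pos hz, Function.comp_apply, jetChart_symm_apply a q hz]

theorem contDiffOn_localLagrangian (hη : IsVolumeForm η)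
    (hL : ContMDiff 𝓘(ℝ, JetModel m n) 𝓘(ℝ, ℝ) ∞ L) :
    ContDiffOn ℝ ∞ (localLagrangian η L a) (a.tot.target ×ˢ univ) := by
  have hη' := hη.smooth a.base a.base_mem
  -- `jetChart` needs some jet as default value. If there is none, the domain is empty, since `glue`
  -- would turn any of its points into a jet.
  by_cases hJ : Nonempty (Jet m n π)
  · obtain ⟨q⟩ := hJ
    have h1 := (contDiffOn_comp_jetChart_symm (a := a) q hL).mono
      (t := a.tot.target ×ˢ univ) (fun z hz => hz)
    have h2 : ContDiffOn ℝ ∞ (fun z : JetModel m n => density η a.base z.1.1)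
        (a.tot.target ×ˢ univ) :=
      hη'.comp (contDiff_fst.fst).contDiffOn (fun z hz => (a.fst_mem_target hz.1).1)
    exact (h1.mul h2).congr fun z hz => localLagrangian_eq q hz.1
  · intro z hz
    exact (hJ ⟨(jetCoords hπ).glue a (a.tot.symm z.1) (a.tot.map_target hz.1) z.2⟩).elim

theorem isOpen_target_prod : IsOpen (a.tot.target ×ˢ (univ : Set (JetFib m n))) :=
  a.tot.open_target.prod isOpen_univ

/-- The density depends on `x` alone, so it behaves as a constant factor under derivatives along the
fibre. -/
theorem fderiv_localLagrangian_vertical (hη : IsVolumeForm η)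
    (hL : ContMDiff 𝓘(ℝ, JetModel m n) 𝓘(ℝ, ℝ) ∞ L) {z : JetModel m n} (hz : z.1 ∈ a.tot.target)
    (v : JetFib m n) :
    fderiv ℝ (localLagrangian η L a) z (0, v) =
      fderiv ℝ (L ∘ (jetChart a q).symm) z (0, v) * density η a.base z.1.1 := by
  have hn : a.tot.target ×ˢ (univ : Set (JetFib m n)) ∈ 𝓝 z :=
    isOpen_target_prod.mem_nhds ⟨hz, mem_univ _⟩
  have h1 : localLagrangian η L a =ᶠ[𝓝 z] fun z =>
      (L ∘ (jetChart a q).symm) z * density η a.base z.1.1 := by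
    filter_upwards [hn] with y hy using localLagrangian_eq q hy.1
  have hd : DifferentiableAt ℝ (L ∘ (jetChart a q).symm) z :=
    ((contDiffOn_comp_jetChart_symm q hL).contDiffAt hn).differentiableAt (by simp)
  have hρ : DifferentiableAt ℝ (density η a.base) z.1.1 :=
    ((hη.smooth a.base a.base_mem).contDiffAt
      (a.base.open_target.mem_nhds (a.fst_mem_target hz).1)).differentiableAt (by simp)
  have h2 : HasFDerivAt (fun z : JetModel m n => density η a.base z.1.1)
      ((fderiv ℝ (density η a.base) z.1.1).comp ((ContinuousLinearMap.fst ℝ _ _).comp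
        (ContinuousLinearMap.fst ℝ _ _))) z :=
    HasFDerivAt.comp (g := density η a.base) (f := fun z : JetModel m n => z.1.1) z
      hρ.hasFDerivAt (hasFDerivAt_fst.comp (f := Prod.fst) z hasFDerivAt_fst)
  rw [h1.fderiv_eq]
  refine (DFunLike.congr_fun (hd.hasFDerivAt.mul h2).fderiv _).trans ?_
  simp [mul_comm]

open Function in
theorem vertEndo_apply (w : Fin m → TangentSpace 𝓘(ℝ, JetModel m n) j)
    (u : TangentSpace 𝓘(ℝ, BaseModel m) (π j.pt)) :
    (j.vertEndo η w).1 u =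
      ∑ i, η (π j.pt) (update (fun k => j.dbase (w k)) i u) • j.vert (j.dpt (w i)) := by
  change ((VertHom m n π j.pt).subtype (∑ i, _)) u = _
  rw [map_sum, sum_apply]
  rfl

-- In coordinates `η` is its density times `stdVol`, and the vertical part of a vector is given by
-- the contact forms; the density comes out of the sum as a common factor.
open Function in
theorem ofVertHom_vertEndo (hj : j.pt ∈ a.tot.source)
    (w : Fin m → TangentSpace 𝓘(ℝ, JetModel m n) j) :
    a.ofVertHom j.pt (j.vertEndo η w) = density η a.base (a.base (π j.pt)) •
      ∑ i, ((stdVol m).toContinuousLinearMap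
        (fun k => (chartDeriv (jetChart a q) j (w k)).1.1) i).smulRight
          ((chartDeriv (jetChart a q) j (w i)).1.2 -
            (jetChart a q j).2 (chartDeriv (jetChart a q) j (w i)).1.1) := by
  have h2 := chartDeriv_isInvertible a.base_mem (a.mapsTo hj)
  ext1 u
  change (chartDeriv a.tot j.pt ((j.vertEndo η w).1
    ((chartDeriv a.base (π j.pt)).inverse u))).2 = _
  rw [vertEndo_apply, map_sum, Prod.snd_sum, smul_apply, sum_apply, Finset.smul_sum]
  refine Finset.sum_congr rfl fun i _ => ?_
  rw [map_smul, chartDeriv_vert q hj, chartDeriv_dpt q hj,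
    form_apply_eq_density_mul η a.base_mem (a.mapsTo hj)]
  have h3 : (fun k => chartDeriv a.base (π j.pt) (update (fun k => j.dbase (w k)) i
      ((chartDeriv a.base (π j.pt)).inverse u) k)) =
      update (fun k => (chartDeriv (jetChart a q) j (w k)).1.1) i u := by
    ext1 k
    by_cases hk : k = i
    · subst hk
      simp [h2]
    · simp only [update_of_ne hk]
      exact chartDeriv_dbase q hj _
  rw [h3, Prod.smul_snd, mul_smul]
  rfl

/-! ### The local Poincaré–Cartan form -/

/-- The value at `z` of `∂ℓ/∂v^A_α (dy^A - v^A_β dx^β) ∧ i(∂/∂x^α) dx + ℓ dx`. -/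
def localForm (ℓ : JetModel m n → ℝ) (z : JetModel m n) (W : Fin m → JetModel m n) : ℝ :=
  fderiv ℝ ℓ z (0, ∑ i, ((stdVol m).toContinuousLinearMap (fun k => (W k).1.1) i).smulRight
    ((W i).1.2 - z.2 (W i).1.1)) + ℓ z * stdVol m fun k => (W k).1.1

/-- Both summands carry the density of `η` exactly once: one through the vertical endomorphism, the
other through the volume form. It merges with `L` into the local Lagrangian, as if `η` were `dx¹ ∧ …
∧ dxᵐ`. -/
theorem poincareCartan_apply (hL : ContMDiff 𝓘(ℝ, JetModel m n) 𝓘(ℝ, ℝ) ∞ L)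
    (hη : IsVolumeForm η) (hj : j.pt ∈ a.tot.source)
    (w : Fin m → TangentSpace 𝓘(ℝ, JetModel m n) j) :
    poincareCartan η L j w = localForm (localLagrangian η L a) (jetChart a q j)
      fun i => chartDeriv (jetChart a q) j (w i) := by
  have hj' := jet_mem_chart_source a q hj
  have hz : (jetChart a q j).1 ∈ a.tot.target := a.tot.map_source hj
  have h1 : poincareCartan η L j w = j.fibreDeriv L (j.vertEndo η w) + L j * j.volume η w := rfl
  have hρ : (jetChart a q j).1.1 = a.base (π j.pt) := a.fst_eq _ hj
  rw [h1, fibreDeriv_apply q hL hj, localForm, fderiv_localLagrangian_vertical q hη hL hz,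
    localLagrangian_eq q hz, Function.comp_apply, (jetChart a q).left_inv hj', hρ]
  congr 1
  · rw [mul_comm, ← smul_eq_mul, ← map_smul]
    congr 1
    refine Prod.ext (by simp) ?_
    have h2 := chartDeriv_isInvertible a.base_mem (a.mapsTo hj)
    exact ofVertHom_vertEndo q hj w
  · rw [Jet.volume]
    change L j * η (π j.pt) (fun i => j.dbase (w i)) = _
    rw [form_apply_eq_density_mul η a.base_mem (a.mapsTo hj)]
    simp only [chartDeriv_dbase q hj]
    ring

end Coordinates

/-! ### The exterior derivative of the Poincaré–Cartan form on the model. -/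

section LocalForm

variable {m n : ℕ} {ℓ : JetModel m n → ℝ} {z : JetModel m n}

/-- For fixed arguments `W` the point enters through `ℓ`, its differential, and affinely through
`z.2` in the contact forms. The product rule gives one term for each: the Hessian, the variation of
the contact forms, and `dℓ` times the volume. -/
theorem hasFDerivAt_localForm (hℓ : ContDiffAt ℝ ∞ ℓ z) (W : Fin m → JetModel m n) :
    ∃ D : JetModel m n →L[ℝ] ℝ, HasFDerivAt (fun y => localForm ℓ y W) D z ∧ ∀ ζ, D ζ =
      fderiv ℝ (fderiv ℝ ℓ) z ζ
        (0, ∑ i, ((stdVol m).toContinuousLinearMap (fun k => (W k).1.1) i).smulRight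
          ((W i).1.2 - z.2 (W i).1.1)) -
      fderiv ℝ ℓ z (0, ∑ i, ((stdVol m).toContinuousLinearMap (fun k => (W k).1.1) i).smulRight
          (ζ.2 (W i).1.1)) + fderiv ℝ ℓ z ζ * stdVol m fun k => (W k).1.1 := by
  let S : Fin m → BaseModel m →L[ℝ] ℝ := fun i =>
    (stdVol m).toContinuousLinearMap (fun k => (W k).1.1) i
  let V : JetFib m n →ₗ[ℝ] JetModel m n :=
    LinearMap.inr ℝ (TotModel m n) (JetFib m n) ∘ₗ
    { toFun := fun v => ∑ i, (S i).smulRight (v (W i).1.1)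
      map_add' := fun v w => by
        rw [← Finset.sum_add_distrib]
        refine Finset.sum_congr rfl fun i _ => ?_
        ext u
        simp
      map_smul' := fun r v => by
        rw [Finset.smul_sum]
        refine Finset.sum_congr rfl fun i _ => ?_
        ext u
        simp
        ring }
  let c : JetModel m n := (0, ∑ i, (S i).smulRight (W i).1.2)
  have hV : ∀ v : JetFib m n, ((0, ∑ i, (S i).smulRight ((W i).1.2 - v (W i).1.1)) : JetModel m n) =
      c - V v := by
    intro v
    refine Prod.ext (by simp [c, V]) ?_
    simp only [c, V, LinearMap.comp_apply, LinearMap.inr_apply, Prod.snd_sub, LinearMap.coe_mk,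
      AddHom.coe_mk, ← Finset.sum_sub_distrib]
    refine Finset.sum_congr rfl fun i _ => ?_
    ext u
    simp [mul_sub]
  have h1 : HasFDerivAt (fun y : JetModel m n => c - V y.2)
      (-((LinearMap.toContinuousLinearMap V).comp (ContinuousLinearMap.snd ℝ _ _))) z :=
    ((LinearMap.toContinuousLinearMap V).comp
      (ContinuousLinearMap.snd ℝ (TotModel m n) (JetFib m n))).hasFDerivAt.const_sub c
  have h2 : HasFDerivAt (fderiv ℝ ℓ) (fderiv ℝ (fderiv ℝ ℓ) z) z :=
    ((hℓ.fderiv_right (m := 1) (WithTop.coe_le_coe.2 le_top)).differentiableAt (by simp)).hasFDerivAt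
  have h3 : HasFDerivAt ℓ (fderiv ℝ ℓ z) z := (hℓ.differentiableAt (by simp)).hasFDerivAt
  have h4 := (h2.clm_apply h1).add (h3.mul_const (stdVol m fun k => (W k).1.1))
  refine ⟨_, h4.congr_of_eventuallyEq (Filter.Eventually.of_forall fun y => ?_), fun ζ => ?_⟩
  · simp only [localForm]
    exact congrArg (fun t => fderiv ℝ ℓ y t + _) (hV y.2)
  · rw [hV]
    have h5 : ((0, ∑ i, (S i).smulRight (ζ.2 (W i).1.1)) : JetModel m n) = V ζ.2 := rfl
    rw [h5]
    change fderiv ℝ ℓ z (-(V ζ.2)) + fderiv ℝ (fderiv ℝ ℓ) z ζ (c - V z.2) +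
      stdVol m (fun k => (W k).1.1) * fderiv ℝ ℓ z ζ = _
    rw [map_neg]
    ring

open Function in
theorem stdVol_slot_eq_zero (X : Fin m → BaseModel m) {i k : Fin m} (hik : i ≠ k) (hX : X i = 0) :
    (stdVol m).toContinuousLinearMap X k = 0 := by
  ext u
  exact (stdVol m).map_coord_zero i (by simp [update_of_ne hik, hX])

/-- An argument vertical over the base kills every volume factor in which it occurs; the only one
free of it is the one whose slot `i` has been vacated. -/
theorem localForm_eq_of_fst_eq_zero (W : Fin m → JetModel m n) {i : Fin m} (hW : (W i).1.1 = 0) :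
    localForm ℓ z W = fderiv ℝ ℓ z
      (0, ((stdVol m).toContinuousLinearMap (fun k => (W k).1.1) i).smulRight (W i).1.2) := by
  rw [localForm, (stdVol m).map_coord_zero (m := fun k => (W k).1.1) i hW, mul_zero, add_zero,
    Finset.sum_eq_single i]
  · simp [hW]
  · intro k _ hk
    rw [stdVol_slot_eq_zero (fun k => (W k).1.1) hk.symm hW]
    ext u
    simp
  · simp

/-- The value at `z` of the exterior derivative of the local form. -/
def localFormExt (ℓ : JetModel m n → ℝ) (z : JetModel m n) (W : Fin (m + 1) → JetModel m n) : ℝ :=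
  ∑ i, (-1) ^ i.val • fderiv ℝ (fun y => localForm ℓ y (i.removeNth W)) z (W i)

/-- Vectors that are vertical over `E` and null for the Hessian of `ℓ` are characteristic. -/
theorem localFormExt_cons_eq_zero (hℓ : ContDiffAt ℝ ∞ ℓ z) {ζ : JetModel m n} (h1 : ζ.1 = 0)
    (h2 : ∀ v : JetFib m n, fderiv ℝ (fderiv ℝ ℓ) z ζ (0, v) = 0) (W : Fin m → JetModel m n) :
    localFormExt ℓ z (Fin.cons ζ W) = 0 := by
  rw [localFormExt, Fin.sum_univ_succ]
  -- When a slot other than the first is omitted, `ζ` is still an argument. It is vertical over `E`,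
  -- so the form vanishes identically in `y` and so does its derivative.
  have hs : ∀ i : Fin m, fderiv ℝ (fun y => localForm ℓ y
      (i.succ.removeNth (Fin.cons ζ W : Fin (m + 1) → JetModel m n))) z (W i) = 0 := by
    intro i
    -- Having `i : Fin m` makes `m` a successor, so that a slot `0` remains after an omission, and
    -- `ζ` sits there.
    have hm : m ≠ 0 := by
      rintro rfl
      exact i.elim0
    obtain ⟨k, rfl⟩ := Nat.exists_eq_succ_of_ne_zero hm
    have : (fun y => localForm ℓ y
        (i.succ.removeNth (Fin.cons ζ W : Fin (k + 1 + 1) → JetModel (k + 1) n))) = fun _ => 0 := by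
      ext y
      have h0 : i.succ.removeNth (Fin.cons ζ W : Fin (k + 1 + 1) → JetModel (k + 1) n) 0 = ζ := by
        simp [Fin.removeNth]
      rw [localForm_eq_of_fst_eq_zero _ (i := 0) (by rw [h0, h1]; rfl), h0, h1]
      have h3 : ∀ f : BaseModel (k + 1) →L[ℝ] ℝ,
          ((0, f.smulRight (0 : TotModel (k + 1) n).2) : JetModel (k + 1) n) = 0 := by
        intro f
        refine Prod.ext rfl ?_
        ext u
        simp
      rw [h3, map_zero]
    rw [this]
    simp
  simp only [Fin.cons_succ, Fin.cons_zero, hs, smul_zero, Finset.sum_const_zero, add_zero,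
    Fin.val_zero, pow_zero, one_smul]
  obtain ⟨D, hD, hD'⟩ := hasFDerivAt_localForm hℓ W
  have hr : (0 : Fin (m + 1)).removeNth (Fin.cons ζ W : Fin (m + 1) → JetModel m n) = W := by
    ext1 i
    simp [Fin.removeNth]
  rw [hr, hD.fderiv, hD', h2]
  -- With `ζ` in the omitted slot the Hessian term is zero by hypothesis. By Cramer's rule the
  -- variation of the contact forms is `-dℓ (ζ)` times the volume, which cancels the term coming
  -- from `ℓ dx`.
  have h5 : ∑ i, ((stdVol m).toContinuousLinearMap (fun k => (W k).1.1) i).smulRight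
      (ζ.2 (W i).1.1) = stdVol m (fun k => (W k).1.1) • ζ.2 := by
    ext1 u
    have h6 := congrArg ζ.2 (sum_stdVol_update_smul (fun k => (W k).1.1) u)
    rw [map_sum, map_smul] at h6
    simp only [map_smul] at h6
    rw [sum_apply]
    exact h6
  have h7 : ((0, stdVol m (fun k => (W k).1.1) • ζ.2) : JetModel m n) =
      stdVol m (fun k => (W k).1.1) • ζ := Prod.ext (by simp [h1]) rfl
  rw [h5, h7, map_smul, smul_eq_mul]
  ring

/-- Moving `u` from slot `0` to slot `i` costs the sign `(-1) ^ i`, and then `stdVol_update_single`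
reads off the coordinate. -/
theorem stdVol_cons_removeNth {k : ℕ} (i : Fin (k + 1)) (u : BaseModel (k + 1)) :
    stdVol (k + 1) (Fin.cons u (i.removeNth fun l => EuclideanSpace.single l (1 : ℝ))) =
      (-1) ^ i.val * u i := by
  rw [← stdVol_update_single i u, ← Fin.insertNth_removeNth]
  exact (((stdVol (k + 1)).toAlternatingMap.neg_one_pow_smul_map_insertNth i u _).symm).trans
    (by simp)

/-- The contraction of the exterior derivative of the local form with the vector `∂/∂y` in the
direction `b` and `m` vectors tangent to a holonomic section. -/
theorem localFormExt_holonomic (hℓ : ContDiffAt ℝ ∞ ℓ z) (W : Fin m → JetModel m n)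
    (hx : ∀ i, (W i).1.1 = EuclideanSpace.single i 1) (hy : ∀ i, (W i).1.2 = z.2 (W i).1.1)
    (b : FibModel n) :
    localFormExt ℓ z (Fin.cons ((0, b), 0) W) = fderiv ℝ ℓ z ((0, b), 0) -
      ∑ i, fderiv ℝ (fderiv ℝ ℓ) z (W i) (0, (EuclideanSpace.proj i).smulRight b) := by
  have hW : (fun k => (W k).1.1) = fun k => EuclideanSpace.single k (1 : ℝ) := funext hx
  have h2 : HasFDerivAt (fderiv ℝ ℓ) (fderiv ℝ (fderiv ℝ ℓ) z) z :=
    ((hℓ.fderiv_right (m := 1) (WithTop.coe_le_coe.2 le_top)).differentiableAt (by simp)).hasFDerivAt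
  -- With `W i` omitted, the vertical vector `∂/∂y` stays in slot `0` and the form reduces to `dℓ`
  -- on `dx^i ⊗ b`, up to sign. Its derivative along `W i` is a Hessian term.
  have hs : ∀ i : Fin m, fderiv ℝ (fun y => localForm ℓ y
      (i.succ.removeNth (Fin.cons ((0, b), 0) W : Fin (m + 1) → JetModel m n))) z (W i) =
      (-1) ^ i.val * fderiv ℝ (fderiv ℝ ℓ) z (W i) (0, (EuclideanSpace.proj i).smulRight b) := by
    intro i
    have hm : m ≠ 0 := by
      rintro rfl
      exact i.elim0
    obtain ⟨k, rfl⟩ := Nat.exists_eq_succ_of_ne_zero hm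
    have h3 : ∀ y, localForm ℓ y
        (i.succ.removeNth (Fin.cons ((0, b), 0) W : Fin (k + 1 + 1) → JetModel (k + 1) n)) =
        fderiv ℝ ℓ y ((-1 : ℝ) ^ i.val • (0, (EuclideanSpace.proj i).smulRight b)) := by
      intro y
      have h0 : i.succ.removeNth (Fin.cons ((0, b), 0) W : Fin (k + 1 + 1) → JetModel (k + 1) n) 0 =
          ((0, b), 0) := by
        simp [Fin.removeNth]
      rw [localForm_eq_of_fst_eq_zero _ (i := 0) (by rw [h0]), h0]
      congr 1
      refine Prod.ext (by simp) ?_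
      ext1 u
      have h4 : Function.update (fun l => (i.succ.removeNth (Fin.cons ((0, b), 0) W :
          Fin (k + 1 + 1) → JetModel (k + 1) n) l).1.1) 0 u =
          Fin.cons u (i.removeNth fun l => EuclideanSpace.single l (1 : ℝ)) := by
        ext1 l
        refine Fin.cases ?_ (fun l => ?_) l
        · simp
        · simp [Fin.removeNth, hx]
      change stdVol (k + 1) (Function.update _ 0 u) • b = (-1 : ℝ) ^ i.val • u i • b
      rw [h4, stdVol_cons_removeNth, mul_smul]
    simp only [h3]
    have h5 := h2.clm_apply (hasFDerivAt_const
      ((-1 : ℝ) ^ i.val • ((0, (EuclideanSpace.proj i).smulRight b) : JetModel (k + 1) n)) z)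
    rw [h5.fderiv]
    change fderiv ℝ ℓ z 0 + fderiv ℝ (fderiv ℝ ℓ) z (W i) ((-1 : ℝ) ^ i.val • _) = _
    rw [map_zero, zero_add, map_smul, smul_eq_mul]
  rw [localFormExt, Fin.sum_univ_succ]
  simp only [Fin.cons_succ, Fin.cons_zero, hs, Fin.val_zero, pow_zero, one_smul, Fin.val_succ]
  have hr : (0 : Fin (m + 1)).removeNth (Fin.cons ((0, b), 0) W : Fin (m + 1) → JetModel m n) =
      W := by
    ext1 i
    simp [Fin.removeNth]
  obtain ⟨D, hD, hD'⟩ := hasFDerivAt_localForm hℓ W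
  rw [hr, hD.fderiv, hD', hW, stdVol_single,
    sub_eq_add_neg (fderiv ℝ ℓ z ((0, b), 0)), ← Finset.sum_neg_distrib]
  congr 1
  · have h6 : ∀ S : Fin m → BaseModel m →L[ℝ] ℝ,
        ((0, ∑ i, (S i).smulRight ((W i).1.2 - z.2 (W i).1.1)) : JetModel m n) = 0 := by
      intro S
      have h : ∑ i, (S i).smulRight ((W i).1.2 - z.2 (W i).1.1) = 0 := by
        refine Finset.sum_eq_zero fun i _ => ?_
        ext u
        simp [hy]
      rw [h]
      rfl
    have h7 : ∀ S : Fin m → BaseModel m →L[ℝ] ℝ,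
        ((0, ∑ i, (S i).smulRight ((0 : JetFib m n) (W i).1.1)) : JetModel m n) = 0 := by
      intro S
      have h : ∑ i, (S i).smulRight ((0 : JetFib m n) (W i).1.1) = 0 := by
        refine Finset.sum_eq_zero fun i _ => ?_
        ext u
        simp
      rw [h]
      rfl
    rw [h6, h7]
    simp
  · refine Finset.sum_congr rfl fun i _ => ?_
    rw [zsmul_eq_mul, ← mul_assoc]
    push_cast
    -- The sign `(-1) ^ (i + 1)` of the omitted slot and the sign `(-1) ^ i` of the reordering
    -- multiply to `-1`.
    rw [← pow_add, show i.val + 1 + i.val = 2 * i.val + 1 by ring]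
    simp [pow_succ, pow_mul]

end LocalForm

/-! ### The kernel of the Legendre differential is characteristic for `Ω`. -/

section Characteristic

variable {m n : ℕ} {M E : Type*}
  [TopologicalSpace M] [ChartedSpace (BaseModel m) M]
  [TopologicalSpace E] [ChartedSpace (TotModel m n) E] [IsManifold 𝓘(ℝ, TotModel m n) ∞ E]
  {π : E → M} [hπ : IsFibredManifold m n π]
  {a : AdaptedChart m n π} (q : Jet m n π) {j : Jet m n π}
  {L : Jet m n π → ℝ} {η : BaseForm m M}

theorem contDiffAt_localLagrangian (hη : IsVolumeForm η)
    (hL : ContMDiff 𝓘(ℝ, JetModel m n) 𝓘(ℝ, ℝ) ∞ L) {z : JetModel m n} (hz : z.1 ∈ a.tot.target) :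
    ContDiffAt ℝ ∞ (localLagrangian η L a) z :=
  (contDiffOn_localLagrangian hη hL).contDiffAt (isOpen_target_prod.mem_nhds ⟨hz, mem_univ _⟩)

theorem chartForm_poincareCartan (hL : ContMDiff 𝓘(ℝ, JetModel m n) 𝓘(ℝ, ℝ) ∞ L)
    (hη : IsVolumeForm η) {z : JetModel m n} (hz : z.1 ∈ a.tot.target)
    (W : Fin m → JetModel m n) :
    chartForm (poincareCartan η L) (jetChart a q) z W = localForm (localLagrangian η L a) z W := by
  have hz' := (mem_jetChart_target a q).2 hz
  have h1 := poincareCartan_apply q hL hη ((jetChart a q).map_target hz')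
    (fun i => mfderiv 𝓘(ℝ, JetModel m n) 𝓘(ℝ, JetModel m n) (jetChart a q).symm z (W i))
  rw [(jetChart a q).right_inv hz'] at h1
  refine h1.trans ?_
  congr 1
  ext1 i
  exact chartDeriv_mfderiv_symm (jetChart_mem_maximalAtlas a q) hz' (W i)

theorem differentiableAt_chartForm_poincareCartan
    (hL : ContMDiff 𝓘(ℝ, JetModel m n) 𝓘(ℝ, ℝ) ∞ L)
    (hη : IsVolumeForm η) {z : JetModel m n} (hz : z.1 ∈ a.tot.target) :
    DifferentiableAt ℝ (chartForm (poincareCartan η L) (jetChart a q)) z := by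
  refine differentiableAt_alternatingForm fun W => ?_
  obtain ⟨D, hD, -⟩ := hasFDerivAt_localForm (contDiffAt_localLagrangian hη hL hz) W
  refine hD.differentiableAt.congr_of_eventuallyEq ?_
  filter_upwards [isOpen_target_prod.mem_nhds ⟨hz, mem_univ _⟩] with y hy
  exact chartForm_poincareCartan q hL hη hy.1 W

/-- The coordinate expression of the Poincaré–Cartan `(m + 1)`-form in any adapted chart. -/
theorem poincareCartanExt_apply (hL : ContMDiff 𝓘(ℝ, JetModel m n) 𝓘(ℝ, ℝ) ∞ L)
    (hη : IsVolumeForm η) (hj : j.pt ∈ a.tot.source)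
    (w : Fin (m + 1) → TangentSpace 𝓘(ℝ, JetModel m n) j) :
    poincareCartanExt η L j w = -localFormExt (localLagrangian η L a) (jetChart a q j)
      fun i => chartDeriv (jetChart a q) j (w i) := by
  have hz : (jetChart a q j).1 ∈ a.tot.target := a.tot.map_source hj
  -- The change of chart requires differentiability in the preferred chart, which lies over some
  -- other adapted chart `b`.
  obtain ⟨b, hb, hc⟩ := chartAt_jet_eq j
  have hbz : (jetChart b j j).1 ∈ b.tot.target := b.tot.map_source hb
  have h1 := extDerivManifold_eq (poincareCartan η L) (jetChart_mem_maximalAtlas a q)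
    (jet_mem_chart_source a q hj)
    (by rw [hc]; exact differentiableAt_chartForm_poincareCartan j hL hη hbz)
  have h2 : poincareCartanExt η L j w = -extDeriv (chartForm (poincareCartan η L) (jetChart a q))
      (jetChart a q j) (fun i => chartDeriv (jetChart a q) j (w i)) := by
    rw [poincareCartanExt, h1]
    rfl
  rw [h2, extDeriv_apply (differentiableAt_chartForm_poincareCartan q hL hη hz), localFormExt]
  congr 1
  refine Finset.sum_congr rfl fun i _ => ?_
  congr 2
  refine Filter.EventuallyEq.fderiv_eq ?_
  filter_upwards [isOpen_target_prod.mem_nhds ⟨hz, mem_univ _⟩] with y hy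
  exact chartForm_poincareCartan q hL hη hy.1 _

/-- The coordinate expression `(x, y, v) ↦ (x, y, ∂L/∂v)` of the Legendre map. -/
def legendreLocal (g : JetModel m n → ℝ) (z : JetModel m n) : MomModel m n :=
  (z.1, (fderiv ℝ g z).comp (ContinuousLinearMap.inr ℝ (TotModel m n) (JetFib m n)))

theorem momentumChart_legendre (r : Momentum m n π)
    (hL : ContMDiff 𝓘(ℝ, JetModel m n) 𝓘(ℝ, ℝ) ∞ L) (hj : j.pt ∈ a.tot.source) :
    momentumChart a r (legendre L j) =
      legendreLocal (L ∘ (jetChart a q).symm) (jetChart a q j) := by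
  rw [momentumChart_apply a r (p := legendre L j) hj]
  refine Prod.ext rfl ?_
  ext1 v
  change j.fibreDeriv L (a.toVertHom hπ j.pt hj v) = _
  rw [fibreDeriv_apply q hL hj, a.ofVertHom_toVertHom]
  rfl

theorem contDiffAt_comp_jetChart_symm (hL : ContMDiff 𝓘(ℝ, JetModel m n) 𝓘(ℝ, ℝ) ∞ L)
    {z : JetModel m n} (hz : z.1 ∈ a.tot.target) :
    ContDiffAt ℝ ∞ (L ∘ (jetChart a q).symm) z :=
  (contDiffOn_comp_jetChart_symm (a := a) q hL).contDiffAt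
    ((jetChart a q).open_target.mem_nhds ((mem_jetChart_target a q).2 hz))

theorem contDiffAt_legendreLocal {g : JetModel m n → ℝ} {z : JetModel m n}
    (hg : ContDiffAt ℝ ∞ g z) : ContDiffAt ℝ ∞ (legendreLocal g) z :=
  contDiffAt_fst.prodMk ((hg.fderiv_right (m := ∞) (by simp)).clm_comp contDiffAt_const)

theorem contMDiff_legendre (hL : ContMDiff 𝓘(ℝ, JetModel m n) 𝓘(ℝ, ℝ) ∞ L) :
    ContMDiff 𝓘(ℝ, JetModel m n) 𝓘(ℝ, MomModel m n) ∞ (legendre L) := by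
  intro j
  obtain ⟨a, ha⟩ := exists_adaptedChart hπ j.pt
  refine contMDiffAt_of_chart_expr (jetChart_mem_maximalAtlas a j)
    (momentumChart_mem_maximalAtlas a (legendre L j)) (jet_mem_chart_source a j ha)
    (F := legendreLocal (L ∘ (jetChart a j).symm)) ?_
    (contDiffAt_legendreLocal (contDiffAt_comp_jetChart_symm j hL (a.tot.map_source ha)))
  filter_upwards [(jetChart a j).open_source.mem_nhds (jet_mem_chart_source a j ha)] with k hk
  exact ⟨hk, momentumChart_legendre j _ hL hk⟩

/-- Vectors in the kernel of the differential of the Legendre map are vertical over `E` and null for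
the Hessian of `L` along the fibres. -/
theorem chartDeriv_of_dlegendre_eq_zero (hL : ContMDiff 𝓘(ℝ, JetModel m n) 𝓘(ℝ, ℝ) ∞ L)
    (hj : j.pt ∈ a.tot.source) {w : TangentSpace 𝓘(ℝ, JetModel m n) j}
    (hw : dlegendre L j w = 0) :
    (chartDeriv (jetChart a q) j w).1 = 0 ∧ ∀ v : JetFib m n,
      fderiv ℝ (fderiv ℝ (L ∘ (jetChart a q).symm)) (jetChart a q j)
        (chartDeriv (jetChart a q) j w) (0, v) = 0 := by
  have hj' := jet_mem_chart_source a q hj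
  have hz : (jetChart a q j).1 ∈ a.tot.target := a.tot.map_source hj
  have hg := contDiffAt_comp_jetChart_symm q hL hz
  have h1 := chartDeriv_comp_mfderiv (jetChart_mem_maximalAtlas a q)
    (momentumChart_mem_maximalAtlas a (legendre L j)) (f := legendre L)
    (F := legendreLocal (L ∘ (jetChart a q).symm)) hj'
    ((mem_momentumChart_source a _).2 hj)
    (by
      filter_upwards [(jetChart a q).open_source.mem_nhds hj'] with k hk
      exact momentumChart_legendre q _ hL hk)
    ((contMDiff_legendre hL).mdifferentiable (by simp) j)
    ((contDiffAt_legendreLocal hg).differentiableAt (by simp))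
  have h2 := DFunLike.congr_fun h1 w
  have h2' : fderiv ℝ (legendreLocal (L ∘ (jetChart a q).symm)) (jetChart a q j)
      (chartDeriv (jetChart a q) j w) = 0 := by
    refine h2.symm.trans ?_
    refine (congrArg (chartDeriv (momentumChart a (legendre L j)) (legendre L j)) hw).trans ?_
    exact map_zero _
  have h3 : HasFDerivAt (fderiv ℝ (L ∘ (jetChart a q).symm)) _ (jetChart a q j) :=
    ((hg.fderiv_right (m := 1) (WithTop.coe_le_coe.2 le_top)).differentiableAt
      (by simp)).hasFDerivAt
  -- The differential of `(x, y, v) ↦ (x, y, ∂L/∂v)` has two components: the projection to `(x, y)`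
  -- and the Hessian restricted to fibre directions in its second argument.
  have h4 := (hasFDerivAt_fst (𝕜 := ℝ) (p := jetChart a q j)).prodMk
    (h3.clm_comp (hasFDerivAt_const
      (ContinuousLinearMap.inr ℝ (TotModel m n) (JetFib m n)) (jetChart a q j)))
  have h5 : fderiv ℝ (legendreLocal (L ∘ (jetChart a q).symm)) (jetChart a q j) = _ := h4.fderiv
  rw [h5] at h2'
  refine ⟨congrArg Prod.fst h2', fun v => ?_⟩
  have h6 := DFunLike.congr_fun (congrArg Prod.snd h2') v
  simpa using! h6

/-- The Legendre map covers the identity of `E`, so its kernel is vertical over `E`. -/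
theorem dpt_of_dlegendre_eq_zero (hL : ContMDiff 𝓘(ℝ, JetModel m n) 𝓘(ℝ, ℝ) ∞ L)
    {w : TangentSpace 𝓘(ℝ, JetModel m n) j} (hw : dlegendre L j w = 0) : j.dpt w = 0 := by
  obtain ⟨a, ha⟩ := exists_adaptedChart hπ j.pt
  have h1 := (chartDeriv_of_dlegendre_eq_zero j hL ha hw).1
  rw [← chartDeriv_dpt j ha] at h1
  exact (chart_mdifferentiable a.tot_mem).mfderiv_injective ha (h1.trans (map_zero _).symm)

/-- Passing from `L` to the local Lagrangian multiplies by a density in `x` only. As `ζ` has no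
`x`-part, the derivative of the density drops out and nullity for the Hessian is preserved. -/
theorem fderiv_fderiv_localLagrangian_eq_zero (hη : IsVolumeForm η)
    (hL : ContMDiff 𝓘(ℝ, JetModel m n) 𝓘(ℝ, ℝ) ∞ L) {z : JetModel m n} (hz : z.1 ∈ a.tot.target)
    {ζ : JetModel m n} (hζ : ζ.1 = 0) {v : JetFib m n}
    (hv : fderiv ℝ (fderiv ℝ (L ∘ (jetChart a q).symm)) z ζ (0, v) = 0) :
    fderiv ℝ (fderiv ℝ (localLagrangian η L a)) z ζ (0, v) = 0 := by
  have hd : ∀ {g : JetModel m n → ℝ}, ContDiffAt ℝ ∞ g z →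
      HasFDerivAt (fun y => fderiv ℝ g y (0, v)) ((fderiv ℝ (fderiv ℝ g) z).flip (0, v)) z := by
    intro g hg
    have h := (((hg.fderiv_right (m := 1) (WithTop.coe_le_coe.2 le_top)).differentiableAt
      (by simp)).hasFDerivAt).clm_apply (hasFDerivAt_const ((0, v) : JetModel m n) z)
    simpa using! h
  have hρ : DifferentiableAt ℝ (density η a.base) z.1.1 :=
    ((hη.smooth a.base a.base_mem).contDiffAt
      (a.base.open_target.mem_nhds (a.fst_mem_target hz).1)).differentiableAt (by simp)
  have h2 : HasFDerivAt (fun z : JetModel m n => density η a.base z.1.1)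
      ((fderiv ℝ (density η a.base) z.1.1).comp ((ContinuousLinearMap.fst ℝ _ _).comp
        (ContinuousLinearMap.fst ℝ _ _))) z :=
    HasFDerivAt.comp (g := density η a.base) (f := fun z : JetModel m n => z.1.1) z
      hρ.hasFDerivAt (hasFDerivAt_fst.comp (f := Prod.fst) z hasFDerivAt_fst)
  have h3 := (hd (contDiffAt_comp_jetChart_symm q hL hz)).mul h2
  have h4 := hd (contDiffAt_localLagrangian hη hL hz)
  have h5 := h4.unique (h3.congr_of_eventuallyEq (by
    filter_upwards [isOpen_target_prod.mem_nhds ⟨hz, mem_univ _⟩] with y hy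
    exact fderiv_localLagrangian_vertical q hη hL hy.1 v))
  refine (DFunLike.congr_fun h5 ζ).trans ?_
  simp [hζ, hv]

/-- The kernel of the differential of the Legendre map is characteristic for the Poincaré–Cartan
`(m + 1)`-form. -/
theorem poincareCartanExt_eq_zero (hL : ContMDiff 𝓘(ℝ, JetModel m n) 𝓘(ℝ, ℝ) ∞ L)
    (hη : IsVolumeForm η) (v : Fin (m + 1) → TangentSpace 𝓘(ℝ, JetModel m n) j) (i : Fin (m + 1))
    (hv : dlegendre L j (v i) = 0) : poincareCartanExt η L j v = 0 := by
  have key : ∀ v : Fin (m + 1) → TangentSpace 𝓘(ℝ, JetModel m n) j, dlegendre L j (v 0) = 0 →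
      poincareCartanExt η L j v = 0 := by
    intro v hv
    obtain ⟨a, ha⟩ := exists_adaptedChart hπ j.pt
    have hz : (jetChart a j j).1 ∈ a.tot.target := a.tot.map_source ha
    obtain ⟨h1, h2⟩ := chartDeriv_of_dlegendre_eq_zero j hL ha hv
    rw [poincareCartanExt_apply j hL hη ha, neg_eq_zero]
    have h3 : (fun i => chartDeriv (jetChart a j) j (v i)) =
        Fin.cons (chartDeriv (jetChart a j) j (v 0))
          (fun i : Fin m => chartDeriv (jetChart a j) j (v i.succ)) := by
      ext1 i
      refine Fin.cases rfl (fun i => rfl) i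
    rw [h3]
    refine localFormExt_cons_eq_zero (contDiffAt_localLagrangian hη hL hz) h1 (fun u => ?_) _
    exact fderiv_fderiv_localLagrangian_eq_zero j hη hL hz h1 (h2 u)
  by_cases hi : i = 0
  · exact key v (hi ▸ hv)
  · have h1 := (poincareCartanExt η L j).toAlternatingMap.map_swap v hi
    have h2 : poincareCartanExt η L j (v ∘ Equiv.swap i 0) = 0 := key _ (by simpa using hv)
    have h3 : poincareCartanExt η L j v = -poincareCartanExt η L j (v ∘ Equiv.swap i 0) := by
      rw [eq_neg_iff_add_eq_zero, ← eq_neg_iff_add_eq_zero]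
      exact (neg_eq_iff_eq_neg.2 h1).symm
    rw [h3, h2, neg_zero]

end Characteristic

/-! ### Contractions with decomposable multivectors. -/

section ExteriorPowers

variable {m : ℕ} {V V' V'' F : Type*} [AddCommGroup V] [Module ℝ V] [AddCommGroup V'] [Module ℝ V']
  [AddCommGroup V''] [Module ℝ V''] [AddCommGroup F] [Module ℝ F]

theorem contract_ιMulti (f : V [⋀^Fin m]→ₗ[ℝ] F) (Y : Fin m → V) :
    contract f (exteriorPower.ιMulti ℝ m Y) = f Y :=
  exteriorPower.alternatingMapLinearEquiv_apply_ιMulti f Y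

theorem map_map_ιMulti (f : V →ₗ[ℝ] V') (g : V' →ₗ[ℝ] V'') (Y : Fin m → V) :
    exteriorPower.map m g (exteriorPower.map m f (exteriorPower.ιMulti ℝ m Y)) =
      exteriorPower.ιMulti ℝ m fun i => g (f (Y i)) := by
  rw [exteriorPower.map_apply_ιMulti, exteriorPower.map_apply_ιMulti]
  rfl

/-- The `m`-vector `T t₁ ∧ … ∧ T t_m` is a multiple of `X`, and contraction is linear. -/
theorem alternatingMap_apply_eq_zero_of_range_map (T : V →ₗ[ℝ] V') {X : ⋀[ℝ]^m V'}
    (h : LinearMap.range (exteriorPower.map m T) = Submodule.span ℝ {X}) (f : V' [⋀^Fin m]→ₗ[ℝ] F)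
    (hf : contract f X = 0) (t : Fin m → V) : f (fun i => T (t i)) = 0 := by
  have h1 : exteriorPower.map m T (exteriorPower.ιMulti ℝ m t) ∈ Submodule.span ℝ {X} := by
    rw [← h]
    exact ⟨_, rfl⟩
  obtain ⟨c, hc⟩ := Submodule.mem_span_singleton.1 h1
  rw [exteriorPower.map_apply_ιMulti] at hc
  have h2 : f (T ∘ t) = contract f (c • X) := by rw [hc, contract_ιMulti]
  refine h2.trans ?_
  rw [contract, map_smul]
  exact (congrArg (c • ·) hf).trans (smul_zero c)

end ExteriorPowers

/-! ### Transfer of the field equations from `N` to `S`, and their local consequences. -/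

section Projection

variable {m n : ℕ} {M E : Type*}
  [TopologicalSpace M] [ChartedSpace (BaseModel m) M]
  [TopologicalSpace E] [ChartedSpace (TotModel m n) E] [IsManifold 𝓘(ℝ, TotModel m n) ∞ E]
  {π : E → M} [hπ : IsFibredManifold m n π]
  {j : Jet m n π} {L : Jet m n π → ℝ} {η : BaseForm m M} {N S : Set (Jet m n π)}
  {σ : Momentum m n π → Jet m n π}

/-- Along a curve in `N` the maps `FL ∘ σ ∘ FL ∘ γ` and `FL ∘ γ` agree near `0`, and their
velocities are compared. Since the curve stays in `N`, the chain rule applies to whichever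
derivative of `σ` within `legendre L '' N` is chosen. The two sides live over points not
syntactically equal, hence the comparison in the model. -/
theorem dlegendre_dsection_velocity (hL : ContMDiff 𝓘(ℝ, JetModel m n) 𝓘(ℝ, ℝ) ∞ L)
    (hσ : IsSectionOnto L N S σ) {γ : ℝ → Jet m n π}
    (hγ : ContMDiffAt 𝓘(ℝ, ℝ) 𝓘(ℝ, JetModel m n) ∞ γ 0) (hN : ∀ᶠ t in 𝓝 (0 : ℝ), γ t ∈ N) :
    (dlegendre L (σ (legendre L (γ 0)))
      (mfderivWithin 𝓘(ℝ, MomModel m n) 𝓘(ℝ, JetModel m n) σ (legendre L '' N) (legendre L (γ 0))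
        (dlegendre L (γ 0) (mfderiv 𝓘(ℝ, ℝ) 𝓘(ℝ, JetModel m n) γ 0 (1 : ℝ)))) : MomModel m n) =
      dlegendre L (γ 0) (mfderiv 𝓘(ℝ, ℝ) 𝓘(ℝ, JetModel m n) γ 0 (1 : ℝ)) := by
  have hl : ∀ k, HasMFDerivAt 𝓘(ℝ, JetModel m n) 𝓘(ℝ, MomModel m n) (legendre L) k
      (dlegendre L k) := fun k => ((contMDiff_legendre hL).mdifferentiable (by simp) k).hasMFDerivAt
  have h1 := (hγ.mdifferentiableAt (by simp)).hasMFDerivAt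
  have h2 := (hl (γ 0)).comp (0 : ℝ) h1
  have h3 := ((hσ.smooth _ (mem_image_of_mem _ hN.self_of_nhds)).mdifferentiableWithinAt
    (by simp)).hasMFDerivWithinAt
  have h4 : HasMFDerivWithinAt 𝓘(ℝ, ℝ) 𝓘(ℝ, JetModel m n) (σ ∘ legendre L ∘ γ) {t | γ t ∈ N} 0 _ :=
    HasMFDerivWithinAt.comp (0 : ℝ) (g := σ) (f := legendre L ∘ γ) h3 h2.hasMFDerivWithinAt
      (fun t ht => mem_image_of_mem _ ht)
  have h5 := h4.hasMFDerivAt hN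
  have h6 := (hl _).comp (0 : ℝ) h5
  have h7 : legendre L ∘ σ ∘ legendre L ∘ γ =ᶠ[𝓝 0] legendre L ∘ γ := by
    filter_upwards [hN] with t ht
    exact hσ.legendre_apply _ (mem_image_of_mem _ ht)
  exact DFunLike.congr_fun (hasMFDerivAt_unique h6 (h2.congr_of_eventuallyEq h7)) (1 : ℝ)

/-- Tangent vectors of `N` are linear combinations of velocities of curves, and the identity is
linear. -/
theorem dlegendre_dsection (hL : ContMDiff 𝓘(ℝ, JetModel m n) 𝓘(ℝ, ℝ) ∞ L)
    (hσ : IsSectionOnto L N S σ) {v : TangentSpace 𝓘(ℝ, JetModel m n) j}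
    (hv : v ∈ tangentTo N j) :
    (dlegendre L (σ (legendre L j))
      (mfderivWithin 𝓘(ℝ, MomModel m n) 𝓘(ℝ, JetModel m n) σ (legendre L '' N) (legendre L j)
        (dlegendre L j v)) : MomModel m n) = dlegendre L j v := by
  induction hv using Submodule.span_induction with
  | mem v hv =>
    obtain ⟨γ, hγ, hN, h⟩ := hv
    have h0 : γ 0 = j := congrArg Bundle.TotalSpace.proj h
    subst h0
    have h1 := Bundle.TotalSpace.mk_inj.1 h
    rw [← h1]
    exact dlegendre_dsection_velocity hL hσ hγ hN
  | zero =>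
    simp only [map_zero]
    rfl
  | add v w _ _ hv hw =>
    simp only [map_add]
    exact congrArg₂ (fun a b : MomModel m n => a + b) hv hw
  | smul r v _ hv =>
    simp only [map_smul]
    exact congrArg (fun a : MomModel m n => r • a) hv

variable {XN XS : MultiVectorField m (JetModel m n) (Jet m n π)}
  {XP : MultiVectorField m (MomModel m n) (Momentum m n π)}

/-- At the points of the image of the section `σ`, the fields `𝒳` on `N` and on `S = σ (P)` have
decompositions that agree modulo the kernel of the differential of the Legendre map. -/
theorem exists_decomposition (hL : ContMDiff 𝓘(ℝ, JetModel m n) 𝓘(ℝ, ℝ) ∞ L)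
    (hSN : S ⊆ N) (hXN : IsLocallyDecomposableOn N XN) (hXP : IsProjectableOnto L N XN XP)
    (hσ : IsSectionOnto L N S σ) (hXS : IsImageUnder L N σ XP XS) (hj : j ∈ S) :
    ∃ Y Y' : Fin m → TangentSpace 𝓘(ℝ, JetModel m n) j,
      XN j = exteriorPower.ιMulti ℝ m Y ∧ XS j = exteriorPower.ιMulti ℝ m Y' ∧
      ∀ i, dlegendre L j (Y' i) = dlegendre L j (Y i) := by
  obtain ⟨U, hU, Z, hZ⟩ := hXN j (hSN hj)
  have hN := hSN hj
  -- Since `S` is the image of `σ`, its points are fixed by `σ ∘ FL`.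
  have hσj : σ (legendre L j) = j := by
    obtain ⟨p, hp, rfl⟩ := hσ.image_eq.symm ▸ hj
    rw [hσ.legendre_apply p hp]
  -- The value of `XS` is prescribed at `σ (legendre L j)`; a decomposition found there is carried
  -- over to `j` by means of a variable point `k`.
  have key : ∀ k : Jet m n π, k = j → ∀ Y' : Fin m → TangentSpace 𝓘(ℝ, JetModel m n) k,
      XS k = exteriorPower.ιMulti ℝ m Y' →
      (∀ i, (dlegendre L k (Y' i) : MomModel m n) = dlegendre L j (Z i j)) →
      ∃ Y Y' : Fin m → TangentSpace 𝓘(ℝ, JetModel m n) j,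
        XN j = exteriorPower.ιMulti ℝ m Y ∧ XS j = exteriorPower.ιMulti ℝ m Y' ∧
        ∀ i, dlegendre L j (Y' i) = dlegendre L j (Y i) := by
    rintro _ rfl Y' h1 h2
    exact ⟨_, Y', hZ.eq_wedge _ ⟨hN, hU⟩, h1, h2⟩
  refine key _ hσj (fun i => mfderivWithin 𝓘(ℝ, MomModel m n) 𝓘(ℝ, JetModel m n) σ
    (legendre L '' N) (legendre L j) (dlegendre L j (Z i j))) ?_
    fun i => dlegendre_dsection hL hσ (hZ.tangent j ⟨hN, hU⟩ i)
  have h1 := hXP j hN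
  rw [hZ.eq_wedge j ⟨hN, hU⟩] at h1
  have h2 := hXS _ (mem_image_of_mem (legendre L) hN)
  rw [← h1] at h2
  exact h2.trans (map_map_ιMulti _ _ _)

/-- The factors of `XS` and `XN` differ by vectors in the kernel of `TFL`, which are characteristic
for `Ω`; hence the field equation for `XN` holds for `XS` as well. -/
theorem contract_poincareCartanExt_eq_zero (hL : ContMDiff 𝓘(ℝ, JetModel m n) 𝓘(ℝ, ℝ) ∞ L)
    (hη : IsVolumeForm η) (hSN : S ⊆ N) (hXN : IsSolutionOn η L N XN)
    (hXP : IsProjectableOnto L N XN XP)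
    (hσ : IsSectionOnto L N S σ) (hXS : IsImageUnder L N σ XP XS) (hj : j ∈ S)
    (w : TangentSpace 𝓘(ℝ, JetModel m n) j) :
    contract ((poincareCartanExt η L j).toAlternatingMap.curryLeft w) (XS j) = 0 := by
  obtain ⟨Y, Y', hY, hY', h⟩ := exists_decomposition hL hSN hXN.decomposable hXP hσ hXS hj
  have h1 := hXN.field_eq j (hSN hj) w
  rw [hY, contract_ιMulti] at h1
  rw [hY', contract_ιMulti, ← h1]
  refine alternatingMap_eq_of_sub_mem _ (LinearMap.ker (dlegendre L j).toLinearMap) ?_ fun i => ?_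
  · intro v i hv
    exact poincareCartanExt_eq_zero hL hη (Matrix.vecCons w v) i.succ hv
  · rw [LinearMap.mem_ker, map_sub]
    exact sub_eq_zero.2 (h i)

/-- The vertical endomorphism sees vectors only through their projections to `E`, where the factors
of `XS` and `XN` coincide. -/
theorem contract_vertEndo_eq_zero (hL : ContMDiff 𝓘(ℝ, JetModel m n) 𝓘(ℝ, ℝ) ∞ L)
    (hXN : IsSolutionOn η L N XN)
    (hXP : IsProjectableOnto L N XN XP) (hσ : IsSectionOnto L N (semiHolonomicSet η N XN) σ)
    (hXS : IsImageUnder L N σ XP XS) (hj : j ∈ semiHolonomicSet η N XN) :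
    contract (j.vertEndo η) (XS j) = 0 := by
  obtain ⟨Y, Y', hY, hY', h⟩ :=
    exists_decomposition hL (fun _ h => h.1) hXN.decomposable hXP hσ hXS hj
  have h1 := hj.2
  rw [hY, contract_ιMulti] at h1
  rw [hY', contract_ιMulti, ← h1, Jet.vertEndo]
  simp only [AlternatingMap.compLinearMap_apply]
  congr 1
  ext1 i
  have h2 : j.dpt (Y' i - Y i) = 0 :=
    dpt_of_dlegendre_eq_zero hL (by rw [map_sub]; exact sub_eq_zero.2 (h i))
  rw [map_sub] at h2
  exact sub_eq_zero.1 h2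

/-- Each step of the integrability algorithm only discards points. -/
theorem IsFinalIntegrabilitySubmanifold.subset {I : Set (Jet m n π)}
    (hI : IsFinalIntegrabilitySubmanifold S XS I) : I ⊆ S := by
  obtain ⟨i, -, rfl⟩ := hI.stable
  clear hI
  induction i with
  | zero => exact fun x hx => hx.1
  | succ i ih => exact fun x hx => ih hx.1

/-- The vectors tangent to an integral section are annihilated by the forms that annihilate the
field. -/
theorem IsIntegralSection.apply_eq_zero {I : Set (Jet m n π)} {U : Set M} {s : M → Jet m n π}
    (hs : IsIntegralSection I XS U s) {x : M} (hx : x ∈ U) {F : Type*} [AddCommGroup F] [Module ℝ F]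
    (f : TangentSpace 𝓘(ℝ, JetModel m n) (s x) [⋀^Fin m]→ₗ[ℝ] F) (hf : contract f (XS (s x)) = 0)
    (t : Fin m → TangentSpace 𝓘(ℝ, BaseModel m) x) :
    f (fun i => mfderiv 𝓘(ℝ, BaseModel m) 𝓘(ℝ, JetModel m n) s x (t i)) = 0 := by
  exact alternatingMap_apply_eq_zero_of_range_map
    (mfderiv 𝓘(ℝ, BaseModel m) 𝓘(ℝ, JetModel m n) s x).toLinearMap (hs.tangent x hx) f hf t

open Function in
/-- A lift that is annihilated by the vertical endomorphism is holonomic. -/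
theorem dpt_lift_eq_hor (hη : IsVolumeForm η)
    (A : TangentSpace 𝓘(ℝ, BaseModel m) (π j.pt) →ₗ[ℝ] TangentSpace 𝓘(ℝ, JetModel m n) j)
    (hA : ∀ u, j.dbase (A u) = u)
    (hV : ∀ t : Fin m → TangentSpace 𝓘(ℝ, BaseModel m) (π j.pt), j.vertEndo η (fun i => A (t i)) = 0)
    (u : TangentSpace 𝓘(ℝ, BaseModel m) (π j.pt)) : j.dpt (A u) = j.hor u := by
  let b : Module.Basis (Fin m) ℝ (TangentSpace 𝓘(ℝ, BaseModel m) (π j.pt)) :=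
    (EuclideanSpace.basisFun (Fin m) ℝ).toBasis
  have hb : η (π j.pt) b ≠ 0 := by
    have h1 : (η (π j.pt)).toAlternatingMap ≠ 0 := by
      intro h
      refine hη.ne_zero (π j.pt) ?_
      ext v
      exact DFunLike.congr_fun h v
    exact ((η (π j.pt)).toAlternatingMap.map_basis_ne_zero_iff b).2 h1
  have h2 : j.vert.toLinearMap ∘ₗ j.dpt.toLinearMap ∘ₗ A = 0 := by
    refine b.ext fun k => ?_
    -- Evaluating on the basis with `u = b k` puts `b k` twice into every term `i ≠ k`. What
    -- survives is `η (b)` times the vertical part of the lift of `b k`, and `η (b) ≠ 0`.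
    have h3 := DFunLike.congr_fun (congrArg Subtype.val (hV b)) (b k)
    rw [vertEndo_apply] at h3
    simp only [hA] at h3
    rw [Finset.sum_eq_single k] at h3
    · have h4 : update (fun i => b i) k (b k) = b := update_eq_self k b
      rw [h4] at h3
      exact (smul_eq_zero.1 h3).resolve_left hb
    · intro i _ hi
      rw [(η (π j.pt)).map_eq_zero_of_eq _ (i := i) (j := k) (by simp [hi.symm]) hi, zero_smul]
    · simp
  have h5 : j.dpt (A u) - j.hor (dproj m n π j.pt (j.dpt (A u))) = 0 := DFunLike.congr_fun h2 u
  have h6 : dproj m n π j.pt (j.dpt (A u)) = u := hA u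
  rw [h6] at h5
  exact sub_eq_zero.1 h5

/-- The Euler–Lagrange equations at a point, for a holonomic lift that solves the field equations. -/
theorem eulerLagrange_of_lift (hη : IsVolumeForm η) {a : AdaptedChart m n π} (q : Jet m n π)
    (hL : ContMDiff 𝓘(ℝ, JetModel m n) 𝓘(ℝ, ℝ) ∞ L) (hj : j.pt ∈ a.tot.source)
    (A : TangentSpace 𝓘(ℝ, BaseModel m) (π j.pt) →ₗ[ℝ] TangentSpace 𝓘(ℝ, JetModel m n) j)
    (hA : ∀ u, j.dbase (A u) = u) (hhor : ∀ u, j.dpt (A u) = j.hor u)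
    (hΩ : ∀ w, ∀ t : Fin m → TangentSpace 𝓘(ℝ, BaseModel m) (π j.pt),
      poincareCartanExt η L j (Matrix.vecCons w fun i => A (t i)) = 0) (b : FibModel n) :
    fderiv ℝ (localLagrangian η L a) (jetChart a q j) ((0, b), 0) =
      ∑ i, fderiv ℝ (fderiv ℝ (localLagrangian η L a)) (jetChart a q j)
        (chartDeriv (jetChart a q) j
          (A ((chartDeriv a.base (π j.pt)).inverse (EuclideanSpace.single i 1))))
        (0, (EuclideanSpace.proj i).smulRight b) := by
  have hz : (jetChart a q j).1 ∈ a.tot.target := a.tot.map_source hj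
  have hD := chartDeriv_isInvertible (jetChart_mem_maximalAtlas a q) (jet_mem_chart_source a q hj)
  have hκ := chartDeriv_isInvertible a.base_mem (a.mapsTo hj)
  let t : Fin m → TangentSpace 𝓘(ℝ, BaseModel m) (π j.pt) := fun i =>
    (chartDeriv a.base (π j.pt)).inverse (EuclideanSpace.single i 1)
  have ht : ∀ i, chartDeriv a.base (π j.pt) (t i) = EuclideanSpace.single i 1 := by
    intro i
    simp [t, hκ]
  -- The test vector has coordinates `∂/∂y` in the direction `b`, and the `t i` are the coordinate
  -- vectors `∂/∂x^i` of the base.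
  have h1 := hΩ ((chartDeriv (jetChart a q) j).inverse ((0, b), 0)) t
  rw [poincareCartanExt_apply q hL hη hj, neg_eq_zero] at h1
  have h2 : (fun i => chartDeriv (jetChart a q) j (Matrix.vecCons
      ((chartDeriv (jetChart a q) j).inverse ((0, b), 0)) (fun i => A (t i)) i)) =
      Fin.cons ((0, b), 0) fun i => chartDeriv (jetChart a q) j (A (t i)) := by
    ext1 i
    refine Fin.cases ?_ (fun i => rfl) i
    simp [hD]
  have hx : ∀ i, (chartDeriv (jetChart a q) j (A (t i))).1.1 = EuclideanSpace.single i 1 := by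
    intro i
    rw [← chartDeriv_dbase q hj, hA, ht]
  rw [h2, localFormExt_holonomic (contDiffAt_localLagrangian hη hL hz) _ hx ?_] at h1
  · exact sub_eq_zero.1 h1
  · intro i
    -- Holonomy says exactly that the contact forms vanish on the lifted vectors.
    rw [hx, ← chartDeriv_dpt q hj, hhor, chartDeriv_hor hj, ht]
    rfl

end Projection

/-! ### Integral sections are prolongations of solutions. -/

section Solutions

variable {m n : ℕ} {M E : Type*}
  [TopologicalSpace M] [ChartedSpace (BaseModel m) M]
  [TopologicalSpace E] [ChartedSpace (TotModel m n) E] [IsManifold 𝓘(ℝ, TotModel m n) ∞ E]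
  {π : E → M} [hπ : IsFibredManifold m n π]
  {L : Jet m n π → ℝ} {η : BaseForm m M} {I : Set (Jet m n π)} {U : Set M} {s : M → Jet m n π}
  {XS : MultiVectorField m (JetModel m n) (Jet m n π)}

theorem IsIntegralSection.mdifferentiableAt (hs : IsIntegralSection I XS U s) (hU : IsOpen U)
    {x : M} (hx : x ∈ U) : MDifferentiableAt 𝓘(ℝ, BaseModel m) 𝓘(ℝ, JetModel m n) s x :=
  (hs.smooth.contMDiffAt (hU.mem_nhds hx)).mdifferentiableAt (by simp)

theorem IsIntegralSection.mfderiv_pt (hs : IsIntegralSection I XS U s) (hU : IsOpen U)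
    {x : M} (hx : x ∈ U) (u : TangentSpace 𝓘(ℝ, BaseModel m) x) :
    mfderiv 𝓘(ℝ, BaseModel m) 𝓘(ℝ, TotModel m n) (fun x => (s x).pt) x u =
      (s x).dpt (mfderiv 𝓘(ℝ, BaseModel m) 𝓘(ℝ, JetModel m n) s x u) := by
  have h := ((contMDiff_jet_pt.mdifferentiable (by simp) (s x)).hasMFDerivAt).comp x
    (hs.mdifferentiableAt hU hx).hasMFDerivAt
  exact DFunLike.congr_fun h.mfderiv u

/-- The differential of a section, with domain the tangent space at the base point of its value. -/
def sectionLift (s : M → Jet m n π) (x : M) :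
    TangentSpace 𝓘(ℝ, BaseModel m) (π (s x).pt) →ₗ[ℝ] TangentSpace 𝓘(ℝ, JetModel m n) (s x) :=
  -- The tangent spaces at `x` and at `π (s x).pt` both unfold to the model, so no transport along
  -- the equality of the two points is needed.
  (mfderiv 𝓘(ℝ, BaseModel m) 𝓘(ℝ, JetModel m n) s x :
    BaseModel m →L[ℝ] JetModel m n).toLinearMap

/-- Differentiation of `π ∘ Jet.pt ∘ s = id`, valid near `x` because `U` is open. -/
theorem IsIntegralSection.dbase_sectionLift (hs : IsIntegralSection I XS U s) (hU : IsOpen U)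
    {x : M} (hx : x ∈ U) (u : TangentSpace 𝓘(ℝ, BaseModel m) (π (s x).pt)) :
    (s x).dbase (sectionLift s x u) = u := by
  have h1 := ((contMDiff_jet_pt.mdifferentiable (by simp) (s x)).hasMFDerivAt).comp x
    (hs.mdifferentiableAt hU hx).hasMFDerivAt
  have h2 := ((hπ.submersion.contMDiff.mdifferentiable (by simp) (s x).pt).hasMFDerivAt).comp x h1
  have h3 : π ∘ Jet.pt ∘ s =ᶠ[𝓝 x] id := by
    filter_upwards [hU.mem_nhds hx] with y hy using hs.isSection y hy
  have h4 := hasMFDerivAt_unique h2 ((hasMFDerivAt_id x).congr_of_eventuallyEq h3)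
  exact DFunLike.congr_fun h4 u

theorem IsIntegralSection.dpt_sectionLift (hη : IsVolumeForm η) (hs : IsIntegralSection I XS U s)
    (hU : IsOpen U) {x : M} (hx : x ∈ U) (hV : contract ((s x).vertEndo η) (XS (s x)) = 0)
    (u : TangentSpace 𝓘(ℝ, BaseModel m) (π (s x).pt)) :
    (s x).dpt (sectionLift s x u) = (s x).hor u :=
  dpt_lift_eq_hor hη (sectionLift s x) (hs.dbase_sectionLift hU hx)
    (fun t => hs.apply_eq_zero hx _ hV t) u

/-- An integral section of a semi-holonomic field is the prolongation of its projection. -/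
theorem IsIntegralSection.isJetOf (hη : IsVolumeForm η) (hs : IsIntegralSection I XS U s)
    (hU : IsOpen U) {x : M} (hx : x ∈ U) (hV : contract ((s x).vertEndo η) (XS (s x)) = 0) :
    (s x).IsJetOf fun x => (s x).pt := by
  intro u
  -- `IsJetOf` differentiates at `π (s x).pt`, while the computation is made at `x`; the two points
  -- are equal only propositionally.
  have key : ∀ y : M, y = x → ∀ v : BaseModel m,
      (⟨(s y).pt, mfderiv 𝓘(ℝ, BaseModel m) 𝓘(ℝ, TotModel m n) (fun x => (s x).pt) y v⟩ :
        TangentBundle 𝓘(ℝ, TotModel m n) E) =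
      ⟨(s x).pt, mfderiv 𝓘(ℝ, BaseModel m) 𝓘(ℝ, TotModel m n) (fun x => (s x).pt) x v⟩ := by
    rintro _ rfl v
    rfl
  refine Eq.trans ?_ (key _ (hs.isSection x hx) u).symm
  refine Bundle.TotalSpace.mk_inj.2 ?_
  exact (hs.dpt_sectionLift hη hU hx hV u).symm.trans (hs.mfderiv_pt hU hx u).symm

variable {a : AdaptedChart m n π}

theorem chartDeriv_inverse_congr {e : OpenPartialHomeomorph M (BaseModel m)} {x y : M} (h : x = y)
    (u : BaseModel m) :
    ((chartDeriv e x).inverse u : BaseModel m) = (chartDeriv e y).inverse u := by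
  subst h
  rfl

/-- In coordinates, an integral section of a semi-holonomic field is the prolongation of its
projection. -/
theorem IsIntegralSection.jetChart_eq_localProlongation (hη : IsVolumeForm η)
    (hs : IsIntegralSection I XS U s) (hU : IsOpen U) (q : Jet m n π) {x : BaseModel m}
    (hxa : x ∈ a.base.target) (hx : a.base.symm x ∈ U)
    (hxt : (s (a.base.symm x)).pt ∈ a.tot.source)
    (hV : contract ((s (a.base.symm x)).vertEndo η) (XS (s (a.base.symm x))) = 0) :
    jetChart a q (s (a.base.symm x)) = localProlongation a (fun x => (s x).pt) x := by
  have hbase := hs.isSection _ hx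
  have hx0 := a.base.map_target hxa
  have hφ : MDifferentiableAt 𝓘(ℝ, BaseModel m) 𝓘(ℝ, TotModel m n) (fun x => (s x).pt)
      (a.base.symm x) :=
    (contMDiff_jet_pt.mdifferentiable (by simp) _).comp _ (hs.mdifferentiableAt hU hx)
  obtain ⟨h1, h2⟩ := chartDeriv_mfderiv_apply a.tot_mem (f := fun x => (s x).pt) hxt a.base_mem
    hx0 hφ
  rw [a.base.right_inv hxa] at h1 h2
  have h3 : fderiv ℝ (localSection a fun x => (s x).pt) x =
      (ContinuousLinearMap.snd ℝ _ _).comp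
        (fderiv ℝ (a.tot ∘ (fun x => (s x).pt) ∘ a.base.symm) x) :=
    ((ContinuousLinearMap.snd ℝ (BaseModel m) (FibModel n)).hasFDerivAt.comp x
      h1.hasFDerivAt).fderiv
  refine Prod.ext (Prod.ext ?_ rfl) ?_
  · change (a.tot (s (a.base.symm x)).pt).1 = x
    rw [a.fst_eq _ hxt, hbase, a.base.right_inv hxa]
  · change a.ofTangent _ _ = fderiv ℝ (localSection a fun x => (s x).pt) x
    rw [h3]
    ext1 v
    have h4 := DFunLike.congr_fun h2
      ((chartDeriv a.base (a.base.symm x)).inverse v)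
    have hκ := chartDeriv_isInvertible a.base_mem hx0
    simp only [ContinuousLinearMap.comp_apply] at h4
    have h5 : chartDeriv a.base (a.base.symm x)
        ((chartDeriv a.base (a.base.symm x)).inverse v) = v := by simp [hκ]
    rw [h5, hs.mfderiv_pt hU hx] at h4
    refine Eq.trans ?_ (congrArg Prod.snd h4)
    -- Holonomy replaces the jet `hor` by the differential of the projected section, whose `y`-part
    -- is the derivative of `localSection`.
    have h6 := hs.dpt_sectionLift hη hU hx hV
      ((chartDeriv a.base (π (s (a.base.symm x)).pt)).inverse v)
    refine Eq.trans (congrArg (fun w => (chartDeriv a.tot (s (a.base.symm x)).pt w).2) h6.symm) ?_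
    exact congrArg (fun w : BaseModel m => (chartDeriv a.tot (s (a.base.symm x)).pt
      ((s (a.base.symm x)).dpt (mfderiv 𝓘(ℝ, BaseModel m) 𝓘(ℝ, JetModel m n) s
        (a.base.symm x) w))).2) (chartDeriv_inverse_congr hbase v)

/-- The projection of an integral section of a semi-holonomic field that solves the field equations
is a solution of the Euler–Lagrange equations. -/
theorem IsIntegralSection.solvesEulerLagrange (hη : IsVolumeForm η)
    (hL : ContMDiff 𝓘(ℝ, JetModel m n) 𝓘(ℝ, ℝ) ∞ L)
    (hs : IsIntegralSection I XS U s) (hU : IsOpen U)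
    (hV : ∀ x ∈ U, contract ((s x).vertEndo η) (XS (s x)) = 0)
    (hΩ : ∀ x ∈ U, ∀ w,
      contract ((poincareCartanExt η L (s x)).toAlternatingMap.curryLeft w) (XS (s x)) = 0) :
    SolvesEulerLagrange η L U fun x => (s x).pt := by
  intro a x hxa hx hxt A
  have hxt' : (s (a.base.symm x)).pt ∈ a.tot.source := hxt
  have hx0 := a.base.map_target hxa
  have hbase := hs.isSection _ hx
  set j := s (a.base.symm x) with hj
  obtain ⟨h1, h2⟩ := chartDeriv_mfderiv_apply (jetChart_mem_maximalAtlas a j) (f := s)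
    (jet_mem_chart_source a j hxt') a.base_mem hx0 (hs.mdifferentiableAt hU hx)
  rw [a.base.right_inv hxa] at h1 h2
  -- Agreement near `x`, not just at `x`, is needed because the Euler–Lagrange equation
  -- differentiates along the prolongation.
  have hev : localProlongation a (fun x => (s x).pt) =ᶠ[𝓝 x] jetChart a j ∘ s ∘ a.base.symm := by
    have hc : ContinuousAt a.base.symm x := a.base.continuousAt_symm hxa
    have hcs : ContinuousAt (fun x => (s x).pt) (a.base.symm x) :=
      (contMDiff_jet_pt.continuous.continuousAt).comp
        (hs.mdifferentiableAt hU hx).continuousAt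
    filter_upwards [a.base.open_target.mem_nhds hxa, hc.preimage_mem_nhds (hU.mem_nhds hx),
      (hcs.comp hc).preimage_mem_nhds (a.tot.open_source.mem_nhds hxt')] with y h1 h2 h3
    exact (hs.jetChart_eq_localProlongation hη hU j h1 h2 h3 (hV _ h2)).symm
  have hz : (jetChart a j j).1 ∈ a.tot.target := a.tot.map_source hxt'
  have hzx : localProlongation a (fun x => (s x).pt) x = jetChart a j j := hev.self_of_nhds
  -- By the chain rule the total derivative of `∂ℓ/∂v` along the prolongation is the Hessian applied
  -- to the differential of `s` in coordinates.
  have hD : ∀ v i, fderiv ℝ (fun x' => fderiv ℝ (localLagrangian η L a)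
      (localProlongation a (fun x => (s x).pt) x') (0, v)) x (EuclideanSpace.single i 1) =
      fderiv ℝ (fderiv ℝ (localLagrangian η L a)) (jetChart a j j)
        (fderiv ℝ (jetChart a j ∘ s ∘ a.base.symm) x (EuclideanSpace.single i 1)) (0, v) := by
    intro v i
    have h3 : HasFDerivAt (fderiv ℝ (localLagrangian η L a)) _
        ((jetChart a j ∘ s ∘ a.base.symm) x) :=
      (((contDiffAt_localLagrangian hη hL hz).fderiv_right (m := 1)
        (WithTop.coe_le_coe.2 le_top)).differentiableAt (by simp)).hasFDerivAt
    have h4 := (h3.comp x h1.hasFDerivAt).clm_apply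
      (hasFDerivAt_const ((0, v) : JetModel m n) x)
    have h5 : (fun x' => fderiv ℝ (localLagrangian η L a)
      (localProlongation a (fun x => (s x).pt) x') (0, v)) =ᶠ[𝓝 x] fun x' =>
        (fderiv ℝ (localLagrangian η L a) ∘ (jetChart a j ∘ s ∘ a.base.symm)) x' (0, v) := by
      filter_upwards [hev] with y hy
      rw [hy, Function.comp_apply (f := fderiv ℝ (localLagrangian η L a))]
    rw [h5.fderiv_eq, h4.fderiv]
    simp [hj]
  have key := eulerLagrange_of_lift hη j hL hxt' (sectionLift s (a.base.symm x))
    (hs.dbase_sectionLift hU hx) (hs.dpt_sectionLift hη hU hx (hV _ hx))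
    (fun w t => hs.apply_eq_zero hx _ (hΩ _ hx w) t) (EuclideanSpace.single A 1)
  rw [hzx, key]
  refine Finset.sum_congr rfl fun i _ => ?_
  rw [hD]
  -- It remains to match the two coordinate expressions of the same tangent vector, the image under
  -- `Ts` of `∂/∂x^i`.
  congr 2
  have h6 := DFunLike.congr_fun h2
    ((chartDeriv a.base (a.base.symm x)).inverse (EuclideanSpace.single i 1))
  have hκ := chartDeriv_isInvertible a.base_mem hx0
  have h7 : chartDeriv a.base (a.base.symm x)
      ((chartDeriv a.base (a.base.symm x)).inverse (EuclideanSpace.single i 1)) =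
      EuclideanSpace.single i (1 : ℝ) := by simp [hκ]
  simp only [ContinuousLinearMap.comp_apply] at h6
  rw [h7] at h6
  rw [← h6]
  exact congrArg (fun w : BaseModel m => chartDeriv (jetChart a j) j
    (mfderiv 𝓘(ℝ, BaseModel m) 𝓘(ℝ, JetModel m n) s (a.base.symm x) w))
    (chartDeriv_inverse_congr hbase _)

end Solutions

end

end FieldTheory

/-! ### The theorem. -/

open FieldTheory
theorem mainTheorem6 {m n : ℕ} (hm : 1 < m) {M E : Type*}
    [TopologicalSpace M] [ChartedSpace (BaseModel m) M] [IsManifold 𝓘(ℝ, BaseModel m) ∞ M]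
    [TopologicalSpace E] [ChartedSpace (TotModel m n) E] [IsManifold 𝓘(ℝ, TotModel m n) ∞ E]
    (π : E → M) [IsFibredManifold m n π]
    (η : BaseForm m M) (hη : IsVolumeForm η)
    (L : Jet m n π → ℝ) (hL : ContMDiff 𝓘(ℝ, JetModel m n) 𝓘(ℝ, ℝ) ∞ L)
    (hreg : IsAlmostRegular L)
    (N : Set (Jet m n π)) (hN : IsFinalConstraintSubmanifold η L N)
    (XN : MultiVectorField m (JetModel m n) (Jet m n π)) (hXN : IsSolutionOn η L N XN)
    (XP : MultiVectorField m (MomModel m n) (Momentum m n π)) (hXP : IsProjectableOnto L N XN XP)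
    (σ : Momentum m n π → Jet m n π) (hσ : IsSectionOnto L N (semiHolonomicSet η N XN) σ)
    (XS : MultiVectorField m (JetModel m n) (Jet m n π)) (hXS : IsImageUnder L N σ XP XS)
    (I : Set (Jet m n π))
    (hI : IsFinalIntegrabilitySubmanifold (semiHolonomicSet η N XN) XS I)
    (U : Set M) (hU : IsOpen U)
    (s : M → Jet m n π) (hs : IsIntegralSection I XS U s) :
    ∃ φ : M → E,
      ContMDiffOn 𝓘(ℝ, BaseModel m) 𝓘(ℝ, TotModel m n) ∞ φ U ∧
      (∀ x ∈ U, π (φ x) = x) ∧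
      (∀ x ∈ U, (s x).IsJetOf φ) ∧
      SolvesEulerLagrange η L U φ := by
  have hS : ∀ x ∈ U, s x ∈ semiHolonomicSet η N XN := fun x hx => hI.subset (hs.mem x hx)
  have hV : ∀ x ∈ U, contract ((s x).vertEndo η) (XS (s x)) = 0 := fun x hx =>
    contract_vertEndo_eq_zero hL hXN hXP hσ hXS (hS x hx)
  -- The solution is the projection of `s` to `E`.
  exact ⟨fun x => (s x).pt, contMDiff_jet_pt.comp_contMDiffOn hs.smooth, hs.isSection,
    fun x hx => hs.isJetOf hη hU hx (hV x hx),
    hs.solvesEulerLagrange hη hL hU hV fun x hx => contract_poincareCartanExt_eq_zero hL hη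
      (fun _ h => h.1) hXN hXP hσ hXS (hS x hx)⟩
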